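/- Notation. For a nonsingular real $n\times n$ matrix $B$ ($n\ge 1$) let $L(B)=B\mathbb{Z}^n$, let $L^*=L(B^{-T})$ be its dual, $\lambda_1(L)$ its first minimum, $\rho_{s,c}(x)=\exp(-\pi\|x-c\|^2/s^2)$, and for $\varepsilon>0$ let $\eta_\varepsilon(L)$ be the smallest $s>0$ with $\rho_{1/s,0}(L^*\setminus\{0\})\le\varepsilon$. For a prime $N$, $D_{\mathbb{F}_N^n,s,c}$ denotes the law of $x \bmod N$, where $x\in\mathbb{Z}^n$ is drawn with probability proportional to $\rho_{s,c}(x)$. For a set $S\subseteq\mathbb{R}^n$ let $S_N=S\cap\{0,\dots,N-1\}^n$, viewed in $\mathbb{F}_N^n$. Put $\Delta(p,q)=\sum_x|p(x)-q(x)|$. An integer matrix is in systematic normal form (SNF) if its first row is $(N,b_2,\dots,b_n)$ with $N$ prime and its remaining rows are those of the identity matrix. SNF reduction. Let $R$ be an upper triangular LLL-reduced basis (parameter $3/4$), $T$ a positive integer and $K>0$. An SNF reduction of $R$ at scale $T$ is a pair $(B_{SNF},M)$, with $B_{SNF}$ in SNF with upper left entry $N$ and $M\in GL_n(\mathbb{Z})$,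 such that $B_{SNF}=P M$, where $P$ is the integer matrix with entries $\mathrm{round}(TR_{ij})$ for $i\le j$, $1$ on the subdiagonal, $0$ below it, and with an integer $d$, $|d|\le K\log N$, added to the entry $(1,n)$. Algorithm $\mathcal{B}$ up to the oracle call. The input is a nonsingular integer $n\times n$ matrix $B$, a vector $v\in\mathbb{Z}^n$ and $\delta>0$. Let $B_{LLL}=QR$ be the QR decomposition of an LLL-reduced basis of $L(B)$, let $\hat v=Q^{T}v$, and let $(B_{SNF},M)$ be an SNF reduction of $R$ at scale $T$. Write $L_{SNF}=L(B_{SNF})$ and $N=\det B_{SNF}$. Let $m$ be the least positive integer with $m^{\delta m}\ge N$, $\varepsilon=m^{-5}$, and $s=T\,\eta_\varepsilon(L(B))$. Given a guess $c\in\mathbb{F}_N$, draw $u_{rand}$ uniformly from $(L_{SNF})_N$, put $v_{target}=(c^{-1}T\hat v+u_{rand})\bmod N$ (where $c^{-1}$ is the inverse in $\mathbb{F}_N$, represented in $\{0,\dots,N-1\}$, with $0^{-1}=0$), draw $x_1,\dots,x_m$ independently from $D_{\mathbb{F}_N^n,s,v_{target}}$, and let $a_i$ be the first coordinate of the unique $y_i\in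 (NL_{SNF}^*)_N$ with $x_i+y_i\in (L_{SNF})_N$ (put $y_i=0$ if there is no unique such $y_i$). Finally call the randomized oracle, $(\alpha_1,\dots,\alpha_m)=\mathcal{A}(a_1,\dots,a_m)\in\mathbb{F}_N^m$; $\mathcal{A}$ may also fail, which counts as one further outcome. Let $\mathsf{P}(\alpha_1,\dots,\alpha_m\mid c)$ be the law of the outcome. Statement. For all $\delta,K>0$ there is $C>0$, depending only on $\delta$ and $K$, such that for every input $(B,v)$, every such choice of $Q,R$, every integer $T\ge\max\{2^{Cn}/\lambda_1(L(B)),\,|\det B|\}$, every SNF reduction $(B_{SNF},M)$ of $R$ at scale $T$ with constant $K$, every randomized oracle $\mathcal{A}$, and all $c_1,c_2\in\mathbb{F}_N$, $$\Delta\bigl(\mathsf{P}(\alpha_1,\dots,\alpha_m\mid c_1),\ \mathsf{P}(\alpha_1,\dots,\alpha_m\mid c_2)\bigr)\le m^{-3}.$$ -/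

import Mathlib

open scoped Matrix ENNReal

namespace SNFLattice

/-! ### Lattices in `ℝⁿ` -/

/-- The Euclidean norm of a real vector. -/
noncomputable def euclNorm {n : ℕ} (x : Fin n → ℝ) : ℝ :=
  Real.sqrt (∑ i, x i ^ 2)

/-- `L(B)`: the integer combinations of the columns of `B`. -/
def lattice {n : ℕ} (B : Matrix (Fin n) (Fin n) ℝ) : Set (Fin n → ℝ) :=
  {x | ∃ z : Fin n → ℤ, x = B *ᵥ (fun i => (z i : ℝ))}

/-- `L(B)^*`: the lattice generated by the columns of `B^{-T}`. -/
noncomputable def dualLattice {n : ℕ} (B : Matrix (Fin n) (Fin n) ℝ) : Set (Fin n → ℝ) :=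
  lattice (B⁻¹)ᵀ

/-- An integer matrix seen as a real matrix. -/
def toReal {n : ℕ} (B : Matrix (Fin n) (Fin n) ℤ) : Matrix (Fin n) (Fin n) ℝ :=
  B.map (fun a => (a : ℝ))

/-- The `i`-th successive minimum
`λ_i(L) = inf { r | dim span (L ∩ closed ball of radius r around 0) ≥ i }`. -/
noncomputable def successiveMinimum {n : ℕ} (L : Set (Fin n → ℝ)) (i : ℕ) : ℝ :=
  sInf {r : ℝ | i ≤ Module.finrank ℝ (Submodule.span ℝ (L ∩ {x | euclNorm x ≤ r}))}

/-- The Gaussian function `ρ_{s,c}(x) = exp (-π ‖x - c‖² / s²)`. -/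
noncomputable def rho {n : ℕ} (s : ℝ) (c x : Fin n → ℝ) : ℝ :=
  Real.exp (-Real.pi * euclNorm (x - c) ^ 2 / s ^ 2)

/-- The smoothing parameter `η_ε(L(B))`: the smallest `s > 0` with `ρ_{1/s}(L^* - {0}) ≤ ε`.
The sum is taken in `[0,∞]`. -/
noncomputable def smoothingParameter {n : ℕ} (ε : ℝ) (B : Matrix (Fin n) (Fin n) ℝ) : ℝ :=
  sInf {s : ℝ | 0 < s ∧
    ∑' w : {w : Fin n → ℝ // w ∈ dualLattice B ∧ w ≠ 0},
      ENNReal.ofReal (rho (1 / s) 0 w.1) ≤ ENNReal.ofReal ε}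

/-! ### LLL reduction and reduction to systematic normal form -/

/-- `R` is an upper triangular LLL-reduced basis (with the usual parameter `3/4`).  For an upper
triangular basis the Gram-Schmidt vectors have lengths `|R i i|` and the Gram-Schmidt coefficients
are `R i j / R i i`, so that the two clauses below are size reduction and the Lovász condition. -/
structure IsLLLReduced {n : ℕ} (R : Matrix (Fin n) (Fin n) ℝ) : Prop where
  upper : ∀ i j, j < i → R i j = 0
  size_reduced : ∀ i j, i < j → |R i j| ≤ |R i i| / 2
  lovasz : ∀ i j : Fin n, (i : ℕ) + 1 = (j : ℕ) →
    3 / 4 * R i i ^ 2 ≤ R i j ^ 2 + R j j ^ 2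

/-- `B` is in systematic normal form with upper left entry `N`: the remaining diagonal entries are
`1`, and all entries outside the first row and the diagonal vanish. -/
structure IsSNF {n : ℕ} [NeZero n] (N : ℕ) (B : Matrix (Fin n) (Fin n) ℤ) : Prop where
  prime : N.Prime
  corner : B 0 0 = (N : ℤ)
  diag : ∀ i, i ≠ 0 → B i i = 1
  off : ∀ i j, i ≠ 0 → i ≠ j → B i j = 0

/-- `T` times the perturbed basis: the entries of `R` on and above the diagonal are rounded to the
nearest multiple of `1/T`, `1/T` is put along the subdiagonal, and `d/T` is added to the upper
right entry.  (After multiplication by `T` all entries are integers.) -/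
noncomputable def perturbedBasis {n : ℕ} (R : Matrix (Fin n) (Fin n) ℝ) (T : ℕ) (d : ℤ) :
    Matrix (Fin n) (Fin n) ℤ :=
  Matrix.of fun i j =>
    if i ≤ j then
      round ((T : ℝ) * R i j) + (if (i : ℕ) = 0 ∧ (j : ℕ) + 1 = n then d else 0)
    else if (i : ℕ) = (j : ℕ) + 1 then 1 else 0

/-- `⟨B_SNF, M, T⟩` is a reduction of the upper triangular basis `R` to systematic normal form:
`R` is rounded at scale `1/T` and gets the subdiagonal `1/T`; its upper right entry is shifted by
`d/T` with `|d| ≤ K log N` so that the determinant becomes, up to sign, the prime `N` (after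
scaling by `T`); and the resulting integer basis is brought into systematic normal form by the
unimodular matrix `M`. -/
structure IsSNFReduction {n : ℕ} [NeZero n] (K : ℝ) (R : Matrix (Fin n) (Fin n) ℝ) (N : ℕ)
    (BSNF : Matrix (Fin n) (Fin n) ℤ) (M : GL (Fin n) ℤ) (T : ℕ) : Prop where
  isSNF : IsSNF N BSNF
  reduces : ∃ d : ℤ, |(d : ℝ)| ≤ K * Real.log N ∧
    BSNF = perturbedBasis R T d * (M : Matrix (Fin n) (Fin n) ℤ)

/-! ### The group `𝔽_N^n` -/

/-- The representative in `{0, …, N-1}^n` of an element of `𝔽_N^n`, as a real vector. -/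
def rep {n N : ℕ} (z : Fin n → ZMod N) : Fin n → ℝ := fun i => ((z i).val : ℝ)

/-- `L ∩ 𝔽_N^n`: the points of `L` in the cube `{0, …, N-1}^n`. -/
def cubePoints {n : ℕ} (N : ℕ) (L : Set (Fin n → ℝ)) : Set (Fin n → ZMod N) :=
  {z | rep z ∈ L}

/-- `L_N` for the lattice `L = L(B)`. -/
def latticeMod {n : ℕ} (N : ℕ) (B : Matrix (Fin n) (Fin n) ℤ) : Set (Fin n → ZMod N) :=
  cubePoints N (lattice (toReal B))

/-- `(NL^*)_N` for the lattice `L = L(B)`, where `NL^* = L(N · B^{-T})`. -/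
def scaledDualMod {n : ℕ} (N : ℕ) (B : Matrix (Fin n) (Fin n) ℤ) : Set (Fin n → ZMod N) :=
  cubePoints N (lattice ((N : ℝ) • ((toReal B)⁻¹)ᵀ))

theorem zero_mem_latticeMod {n : ℕ} (N : ℕ) (B : Matrix (Fin n) (Fin n) ℤ) :
    (0 : Fin n → ZMod N) ∈ latticeMod N B := by
  refine ⟨0, ?_⟩
  funext i
  simp [rep, Matrix.mulVec, dotProduct]

open Classical in
/-- The uniform distribution on `L_N`. -/
noncomputable def uniformLatticeMod {n : ℕ} (N : ℕ) [NeZero N]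
    (B : Matrix (Fin n) (Fin n) ℤ) : PMF (Fin n → ZMod N) :=
  PMF.uniformOfFinset (Finset.univ.filter fun z => z ∈ latticeMod N B)
    ⟨0, by simpa using zero_mem_latticeMod N B⟩

open Classical in
/-- `Φ₃(x)`: the unique `y ∈ (NL^*)_N` with `x + y ∈ L_N` (and `0` where there is no unique such
`y`). -/
noncomputable def dualPoint {n : ℕ} (N : ℕ) (B : Matrix (Fin n) (Fin n) ℤ)
    (x : Fin n → ZMod N) : Fin n → ZMod N :=
  if h : ∃! y : Fin n → ZMod N, y ∈ scaledDualMod N B ∧ x + y ∈ latticeMod N B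
    then h.choose else 0

/-! ### The discrete Gaussian -/

/-- The Gaussian weight of an integer point. -/
noncomputable def gaussWeight {n : ℕ} (s : ℝ) (c : Fin n → ℝ) (x : Fin n → ℤ) : ℝ≥0∞ :=
  ENNReal.ofReal (rho s c (fun i => (x i : ℝ)))

theorem summable_gauss_int {s : ℝ} (hs : 0 < s) (c : ℝ) :
    Summable fun k : ℤ => Real.exp (-Real.pi * ((k : ℝ) - c) ^ 2 / s ^ 2) := by
  have hp := Real.pi_pos
  set a : ℝ := Real.pi / s ^ 2 with ha
  have ha0 : 0 < a := by positivity
  have hgeom : Summable fun k : ℤ => Real.exp (-(a / 2) * |(k : ℝ)|) := by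
    apply Summable.of_nat_of_neg
    · have := Real.summable_exp_nat_mul_iff.mpr (show -(a / 2) < 0 by linarith)
      refine this.congr fun k => ?_
      simp [mul_comm]
    · have := Real.summable_exp_nat_mul_iff.mpr (show -(a / 2) < 0 by linarith)
      refine this.congr fun k => ?_
      simp [mul_comm]
  refine Summable.of_nonneg_of_le (fun k => (Real.exp_pos _).le) (fun k => ?_)
    (hgeom.mul_left (Real.exp (a * c ^ 2)))
  rw [← Real.exp_add]
  apply Real.exp_le_exp.mpr
  have h1 : -Real.pi * ((k : ℝ) - c) ^ 2 / s ^ 2 = -(a * ((k : ℝ) - c) ^ 2) := by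
    rw [ha]; ring
  rw [h1]
  have h2 : |(k : ℝ)| ≤ (k : ℝ) ^ 2 := by
    rcases eq_or_ne k 0 with rfl | hk
    · simp
    · have : (1 : ℝ) ≤ |(k : ℝ)| := by exact_mod_cast Int.one_le_abs hk
      nlinarith [sq_abs (k : ℝ)]
  have h3 : (k : ℝ) ^ 2 / 2 - c ^ 2 ≤ ((k : ℝ) - c) ^ 2 := by
    nlinarith [sq_nonneg ((k : ℝ) - 2 * c)]
  nlinarith [mul_le_mul_of_nonneg_left h3 ha0.le, mul_le_mul_of_nonneg_left h2 ha0.le]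

theorem gaussWeight_eq_prod {n : ℕ} (s : ℝ) (c : Fin n → ℝ) (x : Fin n → ℤ) :
    gaussWeight s c x =
      ∏ i, ENNReal.ofReal (Real.exp (-Real.pi * ((x i : ℝ) - c i) ^ 2 / s ^ 2)) := by
  rw [gaussWeight, ← ENNReal.ofReal_prod_of_nonneg (fun i _ => (Real.exp_pos _).le),
    ← Real.exp_sum, rho, euclNorm, Real.sq_sqrt (Finset.sum_nonneg fun i _ => sq_nonneg _),
    Finset.mul_sum, Finset.sum_div]
  rfl

theorem tsum_gaussWeight_ne_top {n : ℕ} {s : ℝ} (hs : 0 < s) (c : Fin n → ℝ) :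
    ∑' x, gaussWeight s c x ≠ ∞ := by
  classical
  let f : Fin n → ℤ → ℝ≥0∞ := fun i k =>
    ENNReal.ofReal (Real.exp (-Real.pi * ((k : ℝ) - c i) ^ 2 / s ^ 2))
  have hf : ∀ i, ∑' k, f i k ≠ ∞ := fun i => (summable_gauss_int hs (c i)).tsum_ofReal_ne_top
  have hle : ∑' x, gaussWeight s c x ≤ ∏ i, ∑' k, f i k := by
    rw [ENNReal.tsum_eq_iSup_sum]
    refine iSup_le fun S => ?_
    calc ∑ x ∈ S, gaussWeight s c x
        ≤ ∑ x ∈ Fintype.piFinset (fun i => S.image fun x => x i), gaussWeight s c x := by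
          refine Finset.sum_le_sum_of_subset fun x hx => ?_
          rw [Fintype.mem_piFinset]
          exact fun i => Finset.mem_image_of_mem (fun x => x i) hx
      _ = ∏ i, ∑ k ∈ S.image (fun x => x i), f i k := by
          rw [Finset.prod_univ_sum]
          exact Finset.sum_congr rfl fun x _ => gaussWeight_eq_prod s c x
      _ ≤ ∏ i, ∑' k, f i k := Finset.prod_le_prod' fun i _ => ENNReal.sum_le_tsum _
  exact ne_top_of_le_ne_top (ENNReal.prod_ne_top fun i _ => hf i) hle

theorem tsum_gaussWeight_ne_zero {n : ℕ} (s : ℝ) (c : Fin n → ℝ) :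
    ∑' x, gaussWeight s c x ≠ 0 := by
  intro h
  have h0 := ENNReal.tsum_eq_zero.mp h 0
  rw [gaussWeight, ENNReal.ofReal_eq_zero] at h0
  exact absurd h0 (not_le.mpr (Real.exp_pos _))

/-- The discrete Gaussian `D_{ℤⁿ,s,c}` with parameter `s > 0` and centre `c ∈ ℝⁿ`. -/
noncomputable def discreteGaussian {n : ℕ} (s : ℝ) (hs : 0 < s) (c : Fin n → ℝ) :
    PMF (Fin n → ℤ) :=
  PMF.normalize (gaussWeight s c) (tsum_gaussWeight_ne_zero s c) (tsum_gaussWeight_ne_top hs c)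

open Classical in
/-- The discrete Gaussian `D_{𝔽_N^n,s,c}`: the discrete Gaussian on `ℤⁿ`, reduced modulo `N` in
every coordinate.  (It is only used for `s > 0`; otherwise the value is a dummy.) -/
noncomputable def gaussianMod {n : ℕ} (N : ℕ) (s : ℝ) (c : Fin n → ℝ) : PMF (Fin n → ZMod N) :=
  if hs : 0 < s then (discreteGaussian s hs c).map fun x i => (x i : ZMod N) else PMF.pure 0

/-! ### Independent samples and statistical distance -/

/-- The law of `m` independent samples from `p`. -/
noncomputable def iid {α : Type*} [Fintype α] (m : ℕ) (p : PMF α) : PMF (Fin m → α) :=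
  PMF.ofFintype (fun a => ∏ i, p (a i)) (by
    classical
    have h := Finset.prod_univ_sum (fun _ : Fin m => (Finset.univ : Finset α)) fun _ a => p a
    rw [Fintype.piFinset_univ] at h
    rw [← h]
    have h1 : ∑ a, p a = 1 := by rw [← tsum_fintype (L := .unconditional _)]; exact p.tsum_coe
    simp [h1])

/-- The statistical distance `Δ(p,q) = ∑ |p(x) - q(x)|` (without a factor `1/2`). -/
noncomputable def statDist {α : Type*} (p q : PMF α) : ℝ :=
  ∑' x, |(p x).toReal - (q x).toReal|

/-! ### The algorithm -/

/-- `t mod N` for a real number `t`, in `[0, N)`. -/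
noncomputable def realMod (N : ℕ) (t : ℝ) : ℝ := t - N * ⌊t / N⌋

/-- `v_target = (c⁻¹ · T · v̂ + u_rand) mod N`; here `c⁻¹` is the inverse in `𝔽_N`, represented in
`{0, …, N-1}` (with `0⁻¹ = 0`). -/
noncomputable def vTarget {n N : ℕ} (T : ℕ) (vhat : Fin n → ℝ) (c : ZMod N)
    (u : Fin n → ZMod N) : Fin n → ℝ :=
  fun i => realMod N ((c⁻¹.val : ℝ) * T * vhat i + rep u i)

/-- The law of the oracle's answer in a run of the algorithm in which the guessed value is `c`:
draw `u_rand` uniformly from `L_N`; draw `x_1, …, x_m` independently from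
`D_{𝔽_N^n, s, v_target}`; let `a_i` be the first coordinate of `y_i = Φ₃(x_i)`; and call the
randomized oracle `A` on `(a_1, …, a_m)`.  The answer `none` means that the oracle fails. -/
noncomputable def coefficientLaw {n m N : ℕ} [NeZero n] [NeZero N]
    (BSNF : Matrix (Fin n) (Fin n) ℤ) (T : ℕ) (s : ℝ) (vhat : Fin n → ℝ)
    (A : (Fin m → ZMod N) → PMF (Option (Fin m → ZMod N))) (c : ZMod N) :
    PMF (Option (Fin m → ZMod N)) :=
  (uniformLatticeMod N BSNF).bind fun u =>
    (iid m (gaussianMod N s (vTarget T vhat c u))).bind fun x =>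
      A fun i => dualPoint N BSNF (x i) 0

end SNFLattice

/-!
The answer of the oracle depends on the guess `c` only through the centre of the Gaussian samples,
so it suffices that the coefficients handed to the oracle are nearly uniform whatever the centre is.

*Reduction to a residue.* Let `L` be generated by a matrix `B` in systematic normal form, with
first row `(N, b₂, …, bₙ)`, and put `w = (1, -b₂, …, -bₙ)`. Then `L` is the kernel modulo `N` of
`x ↦ w · x`, and `(N L^*)_N` is the line spanned by `w`; hence the coefficient of a sample `x` is
`-(w · x) / (w · w)`, a function of the residue `w · x` modulo `N` (`IsSNF.dualPoint_zero`; both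
sides vanish if `w · w = 0`). The statistical distance does not grow under randomized maps, and is
at most `m` times larger for `m` independent samples than for one.

*Equidistribution of the residue.* Expand the law of `w · x` in characters of `ℤ/N`. The Gaussian
average of the character with frequency `k` is a product of one-dimensional sums, and
one-dimensional Poisson summation bounds it by `sⁿ ρ_{1/s}(ℤⁿ - (k/N) w)`. The translates
`ℤⁿ - (k/N) w` partition the dual lattice, so all nontrivial frequencies together contribute at
most `sⁿ ρ_{1/s}(L^* - {0})`, while the total Gaussian mass is at least
`sⁿ (1 - ρ_{1/s}(L^* - {0}))` (`IsSNF.sum_abs_residue_sub_le`).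

*Perturbation.* It remains to see that `ρ_{1/s}(L_SNF^* - {0}) ≤ 3 ε` for `s = T η`, where
`η = η_ε(L(B))`. The lattice `L_SNF` is generated by the rounded basis `P = T R + E`, where the
entries of `E` are at most `1 + K log N`. Forward substitution with the LLL-reduced `R` shows that
the dual vectors of `T R` and of `P` with the same coordinates differ by a relative error of at most
`τ = 16ⁿ (1 + K log N) / (λ₁ T)`. Hence `exp (-π q)` with `q = η² ‖R⁻ᵀ z‖²` changes at most to
`exp (-π (1 - 2 τ) q)`. This is at most `2 exp (-π q)` for `q` small compared with `1 / τ`;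
the other terms are at most `exp (-1 / (16 τ)) exp (-π q / 4)`, and their sum is negligible since
LLL reduction gives `‖z‖² ≤ 512ⁿ q` (`IsLLLReduced.dualGaussSum_perturbed_le`).

*Parameters.* Every requirement on `τ` and `m` follows if `X = λ₁ T` exceeds a product of `2 ^ O(n)`
with a power of `log X` (`exists_scale_constant`), because `log N` is at most `2 ^ O(n) log X`
(`log_det_le`; this is where `|det B| ≤ T` enters) and `N` is at least `X / 2 ^ O(n)`
(`IsLLLReduced.mul_diag_le_det`), which makes `m` at least `9`.
-/

namespace SNFLattice

/-! ### Sums of products over `ℤⁿ` -/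

theorem tsum_pi_prod {ι : Type*} : ∀ {n : ℕ} (f : Fin n → ι → ℝ≥0∞),
    ∑' x : Fin n → ι, ∏ i, f i (x i) = ∏ i, ∑' k, f i k
  | 0, f => by simp [tsum_fintype]
  | n + 1, f => by
    rw [← (Fin.consEquiv fun _ : Fin (n + 1) => ι).tsum_eq, ENNReal.tsum_prod', Fin.prod_univ_succ,
      ← tsum_pi_prod fun i => f i.succ, ← ENNReal.tsum_mul_right]
    refine tsum_congr fun k => ?_
    rw [← ENNReal.tsum_mul_left]
    exact tsum_congr fun x => by simp [Fin.prod_univ_succ, Fin.consEquiv]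

theorem summable_and_tsum_pi_prod {ι : Type*} : ∀ {n : ℕ} (f : Fin n → ι → ℂ)
    (_ : ∀ i, Summable fun k => ‖f i k‖),
    (Summable fun x : Fin n → ι => ‖∏ i, f i (x i)‖) ∧
      ∑' x : Fin n → ι, ∏ i, f i (x i) = ∏ i, ∑' k, f i k
  | 0, f, _ => by
    refine ⟨(hasSum_fintype _).summable, by simp [tsum_fintype]⟩
  | n + 1, f, hf => by
    obtain ⟨h1, h2⟩ := summable_and_tsum_pi_prod (fun i => f i.succ) fun i => hf i.succ
    have key : ∀ p : ι × (Fin n → ι),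
        ∏ i, f i ((Fin.consEquiv fun _ : Fin (n + 1) => ι) p i) =
          f 0 p.1 * ∏ i : Fin n, f i.succ (p.2 i) := fun p => by
      simp [Fin.prod_univ_succ, Fin.consEquiv]
    constructor
    · rw [← (Fin.consEquiv fun _ : Fin (n + 1) => ι).summable_iff]
      refine ((hf 0).mul_norm h1).congr fun p => ?_
      simp only [Function.comp_apply, key]
    · rw [← (Fin.consEquiv fun _ : Fin (n + 1) => ι).tsum_eq, Fin.prod_univ_succ, ← h2,
        tsum_mul_tsum_of_summable_norm (hf 0) h1]
      exact tsum_congr key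

/-! ### Poisson summation for one-dimensional Gaussians -/

theorem summable_dual_gauss_int {s : ℝ} (hs : 0 < s) (θ : ℝ) :
    Summable fun j : ℤ => Real.exp (-Real.pi * s ^ 2 * ((j : ℝ) - θ) ^ 2) := by
  refine (summable_gauss_int (inv_pos.mpr hs) θ).congr fun j => ?_
  congr 1
  field_simp

/-- Poisson summation for the Gaussian with parameter `s` and centre `t`, twisted by the character
`x ↦ e(θ x)`. -/
theorem poisson_gauss_int {s : ℝ} (hs : 0 < s) (t θ : ℝ) :
    ∑' x : ℤ, Complex.exp (2 * Real.pi * Complex.I * θ * x) *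
        (Real.exp (-Real.pi * ((x : ℝ) - t) ^ 2 / s ^ 2) : ℝ) =
      s * ∑' j : ℤ, ((Real.exp (-Real.pi * s ^ 2 * ((j : ℝ) - θ) ^ 2) : ℝ) : ℂ) *
        Complex.exp ((-2 * Real.pi * (j - θ) * t : ℝ) * Complex.I) := by
  have hs' : (s : ℂ) ≠ 0 := by exact_mod_cast hs.ne'
  have ha : 0 < (((1 / s ^ 2 : ℝ) : ℂ)).re := by
    rw [Complex.ofReal_re]; positivity
  have h := Complex.tsum_exp_neg_quadratic ha (t / s ^ 2 + Complex.I * θ)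
  have hroot : (1 : ℂ) / ((1 / s ^ 2 : ℝ) : ℂ) ^ (1 / 2 : ℂ) = s := by
    have : (((1 / s ^ 2 : ℝ) : ℂ)) ^ (1 / 2 : ℂ) = ((1 / s : ℝ) : ℂ) := by
      have e : (1 / 2 : ℂ) = ((1 / 2 : ℝ) : ℂ) := by push_cast; rfl
      rw [e, ← Complex.ofReal_cpow (by positivity), ← Real.sqrt_eq_rpow, Real.sqrt_div zero_le_one,
        Real.sqrt_one, Real.sqrt_sq hs.le]
    rw [this]; push_cast; field_simp
  rw [hroot] at h
  have h1 : ∀ x : ℤ, Complex.exp (2 * Real.pi * Complex.I * θ * x) *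
      (Real.exp (-Real.pi * ((x : ℝ) - t) ^ 2 / s ^ 2) : ℝ) =
      Complex.exp (-Real.pi * t ^ 2 / s ^ 2) *
        Complex.exp (-Real.pi * ((1 / s ^ 2 : ℝ) : ℂ) * x ^ 2 +
          2 * Real.pi * (t / s ^ 2 + Complex.I * θ) * x) := fun x => by
    rw [Complex.ofReal_exp, ← Complex.exp_add, ← Complex.exp_add]
    congr 1
    push_cast
    field_simp
    ring
  have h2 : ∀ j : ℤ, ((Real.exp (-Real.pi * s ^ 2 * ((j : ℝ) - θ) ^ 2) : ℝ) : ℂ) *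
        Complex.exp ((-2 * Real.pi * (j - θ) * t : ℝ) * Complex.I) =
      Complex.exp (-Real.pi * t ^ 2 / s ^ 2) *
        Complex.exp (-Real.pi / ((1 / s ^ 2 : ℝ) : ℂ) *
          (j + Complex.I * (t / s ^ 2 + Complex.I * θ)) ^ 2) := fun j => by
    rw [Complex.ofReal_exp, ← Complex.exp_add, ← Complex.exp_add]
    congr 1
    push_cast
    field_simp
    linear_combination (s ^ 4 * (2 * j * θ + θ ^ 2 * (Complex.I ^ 2 - 1)) +
      2 * s ^ 2 * θ * t * Complex.I + t ^ 2) * Complex.I_sq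
  rw [tsum_congr h1, tsum_congr h2, tsum_mul_left, tsum_mul_left, h]
  ring

theorem norm_tsum_char_mul_gauss_le {s : ℝ} (hs : 0 < s) (t θ : ℝ) :
    ‖∑' x : ℤ, Complex.exp (2 * Real.pi * Complex.I * θ * x) *
        (Real.exp (-Real.pi * ((x : ℝ) - t) ^ 2 / s ^ 2) : ℝ)‖ ≤
      s * ∑' j : ℤ, Real.exp (-Real.pi * s ^ 2 * ((j : ℝ) - θ) ^ 2) := by
  rw [poisson_gauss_int hs, norm_mul, Complex.norm_real, Real.norm_of_nonneg hs.le]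
  refine mul_le_mul_of_nonneg_left ?_ hs.le
  have h : ∀ j : ℤ, ‖((Real.exp (-Real.pi * s ^ 2 * ((j : ℝ) - θ) ^ 2) : ℝ) : ℂ) *
        Complex.exp ((-2 * Real.pi * (j - θ) * t : ℝ) * Complex.I)‖ =
      Real.exp (-Real.pi * s ^ 2 * ((j : ℝ) - θ) ^ 2) := fun j => by
    rw [norm_mul, Complex.norm_exp_ofReal_mul_I, mul_one, Complex.norm_real,
      Real.norm_of_nonneg (Real.exp_pos _).le]
  have hsum := summable_dual_gauss_int hs θ
  refine (norm_tsum_le_tsum_norm ?_).trans_eq (tsum_congr h)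
  exact hsum.congr fun j => (h j).symm

/-- The mass of a Gaussian on `ℤ` is nearly `s`: the dual sum has the term `1` at `0`, and the
others add up to at most `∑ exp (-π s² j²) - 1` in absolute value. -/
theorem mul_two_sub_theta_le_tsum_gauss {s : ℝ} (hs : 0 < s) (t : ℝ) :
    s * (2 - ∑' j : ℤ, Real.exp (-Real.pi * s ^ 2 * (j : ℝ) ^ 2)) ≤
      ∑' x : ℤ, Real.exp (-Real.pi * ((x : ℝ) - t) ^ 2 / s ^ 2) := by
  have hP := poisson_gauss_int hs t 0
  have hsum : Summable fun j : ℤ => Real.exp (-Real.pi * s ^ 2 * (j : ℝ) ^ 2) := by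
    simpa using summable_dual_gauss_int hs 0
  have hre : ∑' x : ℤ, Real.exp (-Real.pi * ((x : ℝ) - t) ^ 2 / s ^ 2) =
      s * ∑' j : ℤ, Real.exp (-Real.pi * s ^ 2 * (j : ℝ) ^ 2) * Real.cos (2 * Real.pi * j * t) := by
    have hS : Summable fun j : ℤ => ((Real.exp (-Real.pi * s ^ 2 * ((j : ℝ) - 0) ^ 2) : ℝ) : ℂ) *
        Complex.exp ((-2 * Real.pi * (j - 0) * t : ℝ) * Complex.I) := by
      apply Summable.of_norm
      refine hsum.congr fun j => ?_
      rw [norm_mul, Complex.norm_exp_ofReal_mul_I, mul_one, Complex.norm_real,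
        Real.norm_of_nonneg (Real.exp_pos _).le, sub_zero]
    have h2 := congrArg Complex.re hP
    simp only [Complex.ofReal_zero, mul_zero, zero_mul, Complex.exp_zero, one_mul] at h2
    rw [← Complex.ofReal_tsum, Complex.ofReal_re, Complex.re_ofReal_mul, Complex.re_tsum] at h2
    · rw [h2]
      congr 1
      refine tsum_congr fun j => ?_
      rw [Complex.re_ofReal_mul, Complex.exp_ofReal_mul_I_re, sub_zero, ← Real.cos_neg]
      congr 2
      ring
    · simpa using hS
  rw [hre]
  refine mul_le_mul_of_nonneg_left ?_ hs.le
  -- Split off the term `j = 0`, which equals `1`, and bound every cosine below by `-1`.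
  have hsum' : Summable fun j : ℤ =>
      Real.exp (-Real.pi * s ^ 2 * (j : ℝ) ^ 2) * Real.cos (2 * Real.pi * j * t) := by
    refine Summable.of_norm_bounded hsum fun j => ?_
    rw [norm_mul, Real.norm_of_nonneg (Real.exp_pos _).le]
    exact mul_le_of_le_one_right (Real.exp_pos _).le (Real.abs_cos_le_one _)
  have h2 : (2 : ℝ) ≤ ∑' j : ℤ, (Real.exp (-Real.pi * s ^ 2 * (j : ℝ) ^ 2) +
      Real.exp (-Real.pi * s ^ 2 * (j : ℝ) ^ 2) * Real.cos (2 * Real.pi * j * t)) := by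
    have := (hsum.add hsum').le_tsum 0 fun j _ => by
      nlinarith [Real.exp_pos (-Real.pi * s ^ 2 * (j : ℝ) ^ 2),
        Real.neg_one_le_cos (2 * Real.pi * j * t)]
    refine le_trans (by norm_num) this
  rw [hsum.tsum_add hsum'] at h2
  linarith

/-! ### The Gaussian mass of the dual lattice -/

theorem euclNorm_sq {n : ℕ} (x : Fin n → ℝ) : euclNorm x ^ 2 = ∑ i, x i ^ 2 :=
  Real.sq_sqrt (Finset.sum_nonneg fun _ _ => sq_nonneg _)

theorem rho_one_div {n : ℕ} (s : ℝ) (x : Fin n → ℝ) :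
    rho (1 / s) 0 x = Real.exp (-Real.pi * s ^ 2 * euclNorm x ^ 2) := by
  rw [rho, sub_zero]
  congr 1
  rw [one_div, inv_pow, div_inv_eq_mul]
  ring

/-- `ρ_{1/s}(L^* - {0})` for the lattice `L = L(A)`. The points of the dual lattice are indexed by
their integer coordinates with respect to the basis `A^{-T}`. -/
noncomputable def dualGaussSum {n : ℕ} (A : Matrix (Fin n) (Fin n) ℝ) (s : ℝ) : ℝ≥0∞ :=
  ∑' z : Fin n → ℤ, if z = 0 then 0 else
    ENNReal.ofReal (rho (1 / s) 0 ((A⁻¹)ᵀ *ᵥ fun i => (z i : ℝ)))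

/-! ### Equidistribution of the discrete Gaussian modulo a lattice in systematic normal form -/

/-- The lattice generated by a matrix `B` in systematic normal form is the kernel modulo `N` of
this linear form. -/
def snfForm {n : ℕ} [NeZero n] (B : Matrix (Fin n) (Fin n) ℤ) (i : Fin n) : ℤ :=
  if i = 0 then 1 else -B 0 i

theorem IsSNF.transpose_mulVec {n N : ℕ} [NeZero n] {B : Matrix (Fin n) (Fin n) ℤ}
    (hB : IsSNF N B) (y : Fin n → ℝ) (i : Fin n) :
    ((toReal B)ᵀ *ᵥ y) i = if i = 0 then N * y 0 else B 0 i * y 0 + y i := by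
  have h : ((toReal B)ᵀ *ᵥ y) i = ∑ l, (B l i : ℝ) * y l := by
    simp [Matrix.mulVec, dotProduct, toReal]
  rw [h]
  split_ifs with hi
  · subst hi
    rw [Finset.sum_eq_single 0, hB.corner]
    · simp
    · intro l _ hl
      rw [hB.off l 0 hl hl]; simp
    · simp
  · rw [Finset.sum_eq_add 0 i (Ne.symm hi), hB.diag i hi]
    · simp
    · rintro l _ ⟨h0, h1⟩
      rw [hB.off l i h0 h1]; simp
    · simp
    · simp

theorem IsSNF.det_eq {n N : ℕ} [NeZero n] {B : Matrix (Fin n) (Fin n) ℤ}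
    (hB : IsSNF N B) : B.det = N := by
  have htri : B.IsUpperTriangular := fun i j hij =>
    hB.off i j (fun h => absurd (show j < i from hij) (by simp [h])) (ne_of_gt hij)
  rw [Matrix.det_of_isUpperTriangular htri, Finset.prod_eq_single 0]
  · exact hB.corner
  · exact fun i _ hi => hB.diag i hi
  · simp

theorem det_toReal {n : ℕ} (B : Matrix (Fin n) (Fin n) ℤ) : (toReal B).det = (B.det : ℝ) :=
  ((Int.castRingHom ℝ).map_det B).symm

/-- The integer coordinates of the vector `j - (k/N) w` of the dual lattice, where `w` is the
linear form `snfForm B` and `0 ≤ k < N`. -/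
def dualCoord {n : ℕ} [NeZero n] {N : ℕ} (B : Matrix (Fin n) (Fin n) ℤ)
    (p : ZMod N × (Fin n → ℤ)) (i : Fin n) : ℤ :=
  if i = 0 then N * p.2 0 - p.1.val else B 0 i * p.2 0 + p.2 i

theorem dualCoord_injective {n : ℕ} [NeZero n] {N : ℕ} [NeZero N] (B : Matrix (Fin n) (Fin n) ℤ) :
    Function.Injective (dualCoord (N := N) B) := by
  rintro ⟨k, j⟩ ⟨k', j'⟩ h
  have h0 : (N : ℤ) * j 0 - k.val = N * j' 0 - k'.val := by
    simpa [dualCoord] using congrFun h 0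
  have hk : k = k' := by
    have := congrArg (fun a : ℤ => (a : ZMod N)) h0
    simpa using this
  subst hk
  have hN : (N : ℤ) ≠ 0 := by exact_mod_cast NeZero.ne N
  have hj0 : j 0 = j' 0 := mul_left_cancel₀ hN (by linarith)
  have hj : j = j' := by
    funext i
    by_cases hi : i = 0
    · rw [hi, hj0]
    · have := congrFun h i
      simp only [dualCoord, hi, if_false, hj0] at this
      linarith
  rw [hj]

theorem IsSNF.dual_mulVec_dualCoord {n N : ℕ} [NeZero n] [NeZero N]
    {B : Matrix (Fin n) (Fin n) ℤ} (hB : IsSNF N B) (p : ZMod N × (Fin n → ℤ)) :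
    ((toReal B)⁻¹)ᵀ *ᵥ (fun i => (dualCoord B p i : ℝ)) =
      fun i => (p.2 i : ℝ) - (p.1.val : ℝ) * snfForm B i / N := by
  have hN : (N : ℝ) ≠ 0 := by exact_mod_cast NeZero.ne N
  have hdet : IsUnit ((toReal B)ᵀ).det := by
    rw [Matrix.det_transpose, det_toReal, hB.det_eq, isUnit_iff_ne_zero]
    exact_mod_cast hN
  have key : (fun i => (dualCoord B p i : ℝ)) =
      (toReal B)ᵀ *ᵥ fun i => (p.2 i : ℝ) - (p.1.val : ℝ) * snfForm B i / N := by
    funext i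
    rw [hB.transpose_mulVec]
    by_cases hi : i = 0
    · simp only [dualCoord, snfForm, hi, if_true]
      push_cast
      field_simp
    · simp only [dualCoord, snfForm, hi, if_true, if_false]
      push_cast
      ring
  rw [key, Matrix.mulVec_mulVec, Matrix.transpose_nonsing_inv, Matrix.nonsing_inv_mul _ hdet,
    Matrix.one_mulVec]

theorem rho_one_div_eq_prod {n : ℕ} (s : ℝ) (x : Fin n → ℝ) :
    rho (1 / s) 0 x = ∏ i, Real.exp (-Real.pi * s ^ 2 * x i ^ 2) := by
  rw [rho_one_div, ← Real.exp_sum, euclNorm_sq, Finset.mul_sum]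

theorem rho_eq_prod {n : ℕ} (s : ℝ) (c x : Fin n → ℝ) :
    rho s c x = ∏ i, Real.exp (-Real.pi * (x i - c i) ^ 2 / s ^ 2) := by
  rw [rho, ← Real.exp_sum, euclNorm_sq, Finset.mul_sum, Finset.sum_div]
  rfl

theorem tsum_rho_shift {n : ℕ} {s : ℝ} (hs : 0 < s) (θ : Fin n → ℝ) :
    ∑' j : Fin n → ℤ, ENNReal.ofReal (rho (1 / s) 0 fun i => (j i : ℝ) - θ i) =
      ENNReal.ofReal
        (∏ i, ∑' j : ℤ, Real.exp (-Real.pi * s ^ 2 * ((j : ℝ) - θ i) ^ 2)) := by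
  rw [ENNReal.ofReal_prod_of_nonneg fun i _ => tsum_nonneg fun j => (Real.exp_pos _).le]
  simp_rw [ENNReal.ofReal_tsum_of_nonneg (fun j => (Real.exp_pos _).le)
    (summable_dual_gauss_int hs _)]
  rw [← tsum_pi_prod]
  refine tsum_congr fun j => ?_
  rw [rho_one_div_eq_prod, ENNReal.ofReal_prod_of_nonneg fun i _ => (Real.exp_pos _).le]

/-- All frequencies `k` together: the vectors `j - (k/N) w` with `(k, j) ≠ 0` are distinct nonzero
vectors of the dual lattice. -/
theorem IsSNF.sum_tsum_le_dualGaussSum {n N : ℕ} [NeZero n] [NeZero N]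
    {B : Matrix (Fin n) (Fin n) ℤ} (hB : IsSNF N B) (s : ℝ) :
    ∑ k : ZMod N, ∑' j : Fin n → ℤ, (if k = 0 ∧ j = 0 then 0 else
      ENNReal.ofReal (rho (1 / s) 0 fun i => (j i : ℝ) - (k.val : ℝ) * snfForm B i / N)) ≤
      dualGaussSum (toReal B) s := by
  have hz : dualCoord (N := N) B (0, 0) = 0 := by
    funext i; simp [dualCoord]
  rw [← tsum_fintype (L := .unconditional _), ← ENNReal.tsum_prod]
  refine le_trans (le_of_eq ?_)
    (ENNReal.tsum_comp_le_tsum_of_injective (dualCoord_injective (N := N) B) _)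
  refine tsum_congr fun p => ?_
  have hiff : dualCoord B p = 0 ↔ p.1 = 0 ∧ p.2 = 0 := by
    conv_lhs => rw [← hz, (dualCoord_injective B).eq_iff, Prod.ext_iff]
  simp only [hiff, hB.dual_mulVec_dualCoord]

/-- The trivial frequency: `ℤⁿ` is contained in the dual lattice. -/
theorem IsSNF.prod_theta_le {n N : ℕ} [NeZero n] [NeZero N]
    {B : Matrix (Fin n) (Fin n) ℤ} (hB : IsSNF N B) {s ε : ℝ} (hs : 0 < s) (hε : 0 ≤ ε)
    (h : dualGaussSum (toReal B) s ≤ ENNReal.ofReal ε) :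
    (∑' j : ℤ, Real.exp (-Real.pi * s ^ 2 * (j : ℝ) ^ 2)) ^ n ≤ 1 + ε := by
  have h1 := (Finset.single_le_sum (fun _ _ => zero_le) (Finset.mem_univ (0 : ZMod N))).trans
    ((hB.sum_tsum_le_dualGaussSum s).trans h)
  have h2 := tsum_rho_shift (n := n) hs (fun _ => 0)
  rw [ENNReal.tsum_eq_add_tsum_ite 0] at h2
  have h3 : ENNReal.ofReal (∏ i : Fin n, ∑' j : ℤ, Real.exp (-Real.pi * s ^ 2 * ((j : ℝ) - 0) ^ 2))
      ≤ ENNReal.ofReal (1 + ε) := by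
    rw [← h2, ENNReal.ofReal_add zero_le_one hε]
    refine add_le_add (ENNReal.ofReal_le_ofReal ?_) (le_trans (le_of_eq ?_) h1)
    · rw [rho_one_div, ← Real.exp_zero]
      refine Real.exp_le_exp.mpr ?_
      have := mul_nonneg (mul_nonneg Real.pi_pos.le (sq_nonneg s))
        (sq_nonneg (euclNorm (fun i : Fin n => ((0 : Fin n → ℤ) i : ℝ) - 0)))
      linarith
    · refine tsum_congr fun j => ?_
      simp
  have h4 := (ENNReal.ofReal_le_ofReal_iff (by linarith)).mp h3
  simpa using h4

/-- The nontrivial frequencies: the translates of `ℤⁿ` are disjoint subsets of the dual lattice. -/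
theorem IsSNF.sum_prod_theta_le {n N : ℕ} [NeZero n] [NeZero N]
    {B : Matrix (Fin n) (Fin n) ℤ} (hB : IsSNF N B) {s ε : ℝ} (hs : 0 < s) (hε : 0 ≤ ε)
    (h : dualGaussSum (toReal B) s ≤ ENNReal.ofReal ε) :
    ∑ k ∈ Finset.univ.erase (0 : ZMod N), ∏ i, ∑' j : ℤ,
      Real.exp (-Real.pi * s ^ 2 * ((j : ℝ) - (k.val : ℝ) * snfForm B i / N) ^ 2) ≤ ε := by
  have h1 := (Finset.sum_le_univ_sum_of_nonneg (s := Finset.univ.erase (0 : ZMod N))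
    fun _ => zero_le).trans ((hB.sum_tsum_le_dualGaussSum s).trans h)
  rw [← ENNReal.ofReal_le_ofReal_iff hε, ENNReal.ofReal_sum_of_nonneg fun k _ =>
    Finset.prod_nonneg fun i _ => tsum_nonneg fun j => (Real.exp_pos _).le]
  refine le_trans (le_of_eq (Finset.sum_congr rfl fun k hk => ?_)) h1
  rw [← tsum_rho_shift hs]
  refine tsum_congr fun j => ?_
  rw [if_neg fun hh => (Finset.ne_of_mem_erase hk) hh.1]

theorem summable_rho_int {n : ℕ} {s : ℝ} (hs : 0 < s) (t : Fin n → ℝ) :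
    Summable fun x : Fin n → ℤ => rho s t fun i => (x i : ℝ) := by
  refine (ENNReal.summable_toReal (tsum_gaussWeight_ne_top hs t)).congr fun x => ?_
  exact ENNReal.toReal_ofReal (Real.exp_pos _).le

theorem tsum_rho_eq_prod {n : ℕ} {s : ℝ} (hs : 0 < s) (t : Fin n → ℝ) :
    ∑' x : Fin n → ℤ, rho s t (fun i => (x i : ℝ)) =
      ∏ i, ∑' k : ℤ, Real.exp (-Real.pi * ((k : ℝ) - t i) ^ 2 / s ^ 2) := by
  rw [← Complex.ofReal_inj, Complex.ofReal_tsum, Complex.ofReal_prod]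
  simp_rw [Complex.ofReal_tsum]
  rw [← (summable_and_tsum_pi_prod _ fun i => ?_).2]
  · exact tsum_congr fun x => by rw [rho_eq_prod, Complex.ofReal_prod]
  · refine (summable_gauss_int hs (t i)).congr fun k => ?_
    rw [Complex.norm_real, Real.norm_of_nonneg (Real.exp_pos _).le]

theorem IsSNF.mul_one_sub_le_tsum_rho {n N : ℕ} [NeZero n] [NeZero N]
    {B : Matrix (Fin n) (Fin n) ℤ} (hB : IsSNF N B) {s ε : ℝ} (hs : 0 < s) (hε : 0 ≤ ε)
    (hε1 : ε < 1) (h : dualGaussSum (toReal B) s ≤ ENNReal.ofReal ε) (t : Fin n → ℝ) :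
    s ^ n * (1 - ε) ≤ ∑' x : Fin n → ℤ, rho s t (fun i => (x i : ℝ)) := by
  have hθ := hB.prod_theta_le hs hε h
  set Θ := ∑' j : ℤ, Real.exp (-Real.pi * s ^ 2 * (j : ℝ) ^ 2) with hΘ
  have hΘ1 : 1 ≤ Θ := by
    have hsum : Summable fun j : ℤ => Real.exp (-Real.pi * s ^ 2 * (j : ℝ) ^ 2) := by
      simpa using summable_dual_gauss_int hs 0
    refine le_trans (by simp) (hsum.le_tsum 0 fun j _ => (Real.exp_pos _).le)
  have hn : (1 : ℝ) ≤ n := by exact_mod_cast NeZero.one_le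
  have h1 := one_add_mul_le_pow (a := Θ - 1) (by linarith) n
  rw [add_sub_cancel] at h1
  have h2 : Θ - 1 ≤ 1 := by nlinarith
  have h3 := one_add_mul_le_pow (a := -(Θ - 1)) (by linarith) n
  rw [tsum_rho_eq_prod hs]
  calc s ^ n * (1 - ε) ≤ s ^ n * (1 + -(Θ - 1)) ^ n := by
        gcongr; linarith
    _ = ∏ _i : Fin n, s * (2 - Θ) := by
        rw [← mul_pow, Finset.prod_const, Finset.card_univ, Fintype.card_fin]; ring
    _ ≤ _ := Finset.prod_le_prod (fun i _ => mul_nonneg hs.le (by linarith))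
        fun i _ => mul_two_sub_theta_le_tsum_gauss hs (t i)

/-- The value modulo `N` of the linear form `snfForm B`. It determines an integer vector up to the
lattice generated by `B`. -/
def snfResidue {n : ℕ} [NeZero n] (N : ℕ) (B : Matrix (Fin n) (Fin n) ℤ) (x : Fin n → ZMod N) :
    ZMod N :=
  ∑ i, (snfForm B i : ZMod N) * x i

/-- A nontrivial character of `ℤⁿ / L` has a small Gaussian average. -/
theorem norm_tsum_stdAddChar_mul_rho_le {n N : ℕ} [NeZero n] [NeZero N]
    (B : Matrix (Fin n) (Fin n) ℤ) {s : ℝ} (hs : 0 < s) (t : Fin n → ℝ) (k : ZMod N) :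
    ‖∑' x : Fin n → ℤ, ZMod.stdAddChar (k * snfResidue N B fun i => (x i : ZMod N)) *
        ((rho s t (fun i => (x i : ℝ)) : ℝ) : ℂ)‖ ≤
      s ^ n * ∏ i, ∑' j : ℤ,
        Real.exp (-Real.pi * s ^ 2 * ((j : ℝ) - (k.val : ℝ) * snfForm B i / N) ^ 2) := by
  have hterm : ∀ x : Fin n → ℤ,
      ZMod.stdAddChar (k * snfResidue N B fun i => (x i : ZMod N)) *
        ((rho s t (fun i => (x i : ℝ)) : ℝ) : ℂ) =
      ∏ i, (Complex.exp (2 * Real.pi * Complex.I * ((k.val : ℝ) * snfForm B i / N : ℝ) * x i) *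
        (Real.exp (-Real.pi * ((x i : ℝ) - t i) ^ 2 / s ^ 2) : ℝ)) := fun x => by
    have hk : k * snfResidue N B (fun i => (x i : ZMod N)) =
        (((k.val : ℤ) * ∑ i, snfForm B i * x i : ℤ) : ZMod N) := by
      simp [snfResidue]
    rw [hk, ZMod.stdAddChar_coe, rho_eq_prod, Complex.ofReal_prod, Finset.prod_mul_distrib,
      ← Complex.exp_sum]
    congr 2
    push_cast
    rw [Finset.mul_sum, Finset.mul_sum, Finset.sum_div]
    exact Finset.sum_congr rfl fun i _ => by ring
  rw [tsum_congr hterm, (summable_and_tsum_pi_prod (fun (i : Fin n) (y : ℤ) =>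
    Complex.exp (2 * Real.pi * Complex.I * ((k.val : ℝ) * snfForm B i / N : ℝ) * y) *
        (Real.exp (-Real.pi * ((y : ℝ) - t i) ^ 2 / s ^ 2) : ℝ)) fun i => ?_).2, norm_prod]
  · refine (Finset.prod_le_prod (fun i _ => norm_nonneg _)
      fun i _ => norm_tsum_char_mul_gauss_le hs (t i) _).trans_eq ?_
    rw [Finset.prod_mul_distrib, Finset.prod_const, Finset.card_univ, Fintype.card_fin]
  · refine (summable_gauss_int hs (t i)).congr fun y => ?_
    have : 2 * Real.pi * Complex.I * ((k.val : ℝ) * snfForm B i / N : ℝ) * y =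
        ((2 * Real.pi * ((k.val : ℝ) * snfForm B i / N) * y : ℝ) : ℂ) * Complex.I := by
      push_cast; ring
    rw [norm_mul, this, Complex.norm_exp_ofReal_mul_I, one_mul, Complex.norm_real,
      Real.norm_of_nonneg (Real.exp_pos _).le]

theorem toReal_map_discreteGaussian {n : ℕ} {α : Type*} [DecidableEq α] {s : ℝ} (hs : 0 < s)
    (t : Fin n → ℝ) (φ : (Fin n → ℤ) → α) (a : α) :
    (((discreteGaussian s hs t).map φ) a).toReal * (∑' x : Fin n → ℤ, rho s t fun i => (x i : ℝ)) =
      ∑' x : Fin n → ℤ, if a = φ x then rho s t (fun i => (x i : ℝ)) else 0 := by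
  have hZ : ∑' x : Fin n → ℤ, gaussWeight s t x =
      ENNReal.ofReal (∑' x : Fin n → ℤ, rho s t fun i => (x i : ℝ)) :=
    (ENNReal.ofReal_tsum_of_nonneg (fun x => (Real.exp_pos _).le) (summable_rho_int hs t)).symm
  have hpos : 0 < ∑' x : Fin n → ℤ, rho s t fun i => (x i : ℝ) :=
    (summable_rho_int hs t).tsum_pos (fun x => (Real.exp_pos _).le) 0 (Real.exp_pos _)
  rw [← eq_div_iff hpos.ne', ← tsum_div_const, PMF.map_apply, ENNReal.tsum_toReal_eq]
  · refine tsum_congr fun x => ?_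
    by_cases hx : a = φ x
    · simp only [hx, if_true]
      rw [discreteGaussian, PMF.normalize_apply, hZ, ENNReal.toReal_mul, ENNReal.toReal_inv,
        ENNReal.toReal_ofReal hpos.le, gaussWeight,
        ENNReal.toReal_ofReal (show 0 ≤ rho _ _ _ from (Real.exp_pos _).le)]
      rfl
    · simp [hx]
  · intro x
    split_ifs
    · exact PMF.apply_ne_top _ _
    · simp

/-- The discrete Gaussian is nearly uniform modulo a lattice in systematic normal form, once its
parameter exceeds the smoothing parameter of the lattice. -/
theorem IsSNF.sum_abs_residue_sub_le {n N : ℕ} [NeZero n] [NeZero N]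
    {B : Matrix (Fin n) (Fin n) ℤ} (hB : IsSNF N B) {s ε : ℝ} (hs : 0 < s) (hε : 0 ≤ ε)
    (hε1 : ε < 1) (h : dualGaussSum (toReal B) s ≤ ENNReal.ofReal ε) (t : Fin n → ℝ) :
    ∑ a : ZMod N, |(((discreteGaussian s hs t).map
      fun x => snfResidue N B fun i => (x i : ZMod N)) a).toReal - 1 / N| ≤ ε / (1 - ε) := by
  classical
  have hN : (0 : ℝ) < N := by exact_mod_cast NeZero.pos N
  set φ : (Fin n → ℤ) → ZMod N := fun x => snfResidue N B fun i => (x i : ZMod N) with hφ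
  set W : (Fin n → ℤ) → ℝ := fun x => rho s t fun i => (x i : ℝ) with hW
  set Z := ∑' x, W x with hZdef
  have hWs : Summable W := summable_rho_int hs t
  have hW0 : ∀ x, 0 ≤ W x := fun x => (Real.exp_pos _).le
  have hZ : s ^ n * (1 - ε) ≤ Z := hB.mul_one_sub_le_tsum_rho hs hε hε1 h t
  have hZ0 : 0 < Z := lt_of_lt_of_le (mul_pos (pow_pos hs n) (by linarith)) hZ
  set S : ZMod N → ℂ := fun k => ∑' x, ZMod.stdAddChar (k * φ x) * (W x : ℂ) with hS
  have hSsum : ∀ k, Summable fun x => ZMod.stdAddChar (k * φ x) * (W x : ℂ) := fun k => by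
    refine Summable.of_norm (hWs.congr fun x => ?_)
    rw [norm_mul, AddChar.norm_apply, one_mul, Complex.norm_real, Real.norm_of_nonneg (hW0 x)]
  -- Fourier inversion on `ℤ/N`
  have hinv : ∀ a, ((N * (((discreteGaussian s hs t).map φ) a).toReal * Z : ℝ) : ℂ) =
      ∑ k : ZMod N, ZMod.stdAddChar (-(k * a)) * S k := fun a => by
    rw [mul_assoc, toReal_map_discreteGaussian]
    have h1 : ∀ k, ZMod.stdAddChar (-(k * a)) * S k =
        ∑' x, ZMod.stdAddChar (k * (φ x - a)) * (W x : ℂ) := fun k => by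
      rw [hS, ← tsum_mul_left]
      refine tsum_congr fun x => ?_
      rw [← mul_assoc, ← AddChar.map_add_eq_mul]
      congr 2
      ring
    have h2 : ∀ k, Summable fun x => ZMod.stdAddChar (k * (φ x - a)) * (W x : ℂ) := fun k => by
      refine Summable.of_norm (hWs.congr fun x => ?_)
      rw [norm_mul, AddChar.norm_apply, one_mul, Complex.norm_real, Real.norm_of_nonneg (hW0 x)]
    rw [Finset.sum_congr rfl fun k _ => h1 k, ← Summable.tsum_finsetSum fun k _ => h2 k,
      Complex.ofReal_mul, Complex.ofReal_tsum, ← tsum_mul_left]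
    refine tsum_congr fun x => ?_
    rw [← Finset.sum_mul, AddChar.sum_mulShift _ (ZMod.isPrimitive_stdAddChar N), ZMod.card]
    by_cases hx : a = φ x
    · simp [hx, hW]
    · have : φ x - a ≠ 0 := sub_ne_zero.mpr (Ne.symm hx)
      simp [hx, this]
  have hS0 : S 0 = (Z : ℂ) := by
    simp only [hS, zero_mul, AddChar.map_zero_eq_one, one_mul]
    rw [hZdef, Complex.ofReal_tsum]
  have hbound : ∀ a, |(((discreteGaussian s hs t).map φ) a).toReal - 1 / N| ≤
      s ^ n * ε / (N * Z) := fun a => by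
    set p := (((discreteGaussian s hs t).map φ) a).toReal with hp
    have h1 : ((N * p * Z - Z : ℝ) : ℂ) =
        ∑ k ∈ Finset.univ.erase (0 : ZMod N), ZMod.stdAddChar (-(k * a)) * S k := by
      rw [Complex.ofReal_sub, hinv, ← Finset.add_sum_erase _ _ (Finset.mem_univ (0 : ZMod N)), hS0]
      simp
    have h2 : |N * p * Z - Z| ≤ s ^ n * ε := by
      rw [← Real.norm_eq_abs, ← Complex.norm_real, h1]
      refine (norm_sum_le _ _).trans ?_
      refine le_trans (Finset.sum_le_sum fun k _ => ?_)
        ((Finset.mul_sum _ _ _).symm.le.trans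
          (mul_le_mul_of_nonneg_left (hB.sum_prod_theta_le hs hε h) (pow_pos hs n).le))
      rw [norm_mul, AddChar.norm_apply, one_mul]
      exact norm_tsum_stdAddChar_mul_rho_le B hs t k
    have h3 : p - 1 / N = (N * p * Z - Z) / (N * Z) := by field_simp
    rw [h3, abs_div, abs_of_pos (mul_pos hN hZ0)]
    gcongr
  refine (Finset.sum_le_sum fun a _ => hbound a).trans ?_
  rw [Finset.sum_const, Finset.card_univ, ZMod.card, nsmul_eq_mul]
  have : (N : ℝ) * (s ^ n * ε / (N * Z)) = s ^ n * ε / Z := by field_simp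
  rw [this, div_le_div_iff₀ hZ0 (by linarith)]
  nlinarith [mul_le_mul_of_nonneg_left hZ hε]

/-! ### Statistical distance -/

theorem toReal_bind_apply {α β : Type*} [Fintype α] (p : PMF α) (F : α → PMF β) (y : β) :
    (p.bind F y).toReal = ∑ x, (p x).toReal * (F x y).toReal := by
  rw [PMF.bind_apply, tsum_fintype,
    ENNReal.toReal_sum fun x _ => ENNReal.mul_ne_top (p.apply_ne_top x) ((F x).apply_ne_top y)]
  simp only [ENNReal.toReal_mul]

section StatDist

variable {α β : Type*} [Fintype α] [Fintype β]

theorem statDist_eq_sum (p q : PMF α) : statDist p q = ∑ x, |(p x).toReal - (q x).toReal| :=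
  tsum_fintype _

theorem sum_toReal_pmf (p : PMF α) : ∑ x, (p x).toReal = 1 := by
  rw [← ENNReal.toReal_sum fun x _ => p.apply_ne_top x, ← tsum_fintype (L := .unconditional _),
    p.tsum_coe, ENNReal.toReal_one]

theorem statDist_le_add (p q r : PMF α) : statDist p q ≤ statDist p r + statDist q r := by
  simp only [statDist_eq_sum, ← Finset.sum_add_distrib]
  refine Finset.sum_le_sum fun x _ => ?_
  rw [abs_sub_comm (q x).toReal]
  exact abs_sub_le _ _ _

/-- Applying one randomized map to two distributions does not increase their distance. -/
theorem statDist_bind_le (p q : PMF α) (F : α → PMF β) :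
    statDist (p.bind F) (q.bind F) ≤ statDist p q := by
  simp only [statDist_eq_sum, toReal_bind_apply, ← Finset.sum_sub_distrib, ← sub_mul]
  calc ∑ y, |∑ x, ((p x).toReal - (q x).toReal) * (F x y).toReal|
      ≤ ∑ y, ∑ x, |(p x).toReal - (q x).toReal| * (F x y).toReal := by
        refine Finset.sum_le_sum fun y _ => (Finset.abs_sum_le_sum_abs _ _).trans_eq ?_
        simp only [abs_mul, ENNReal.abs_toReal]
    _ = ∑ x, |(p x).toReal - (q x).toReal| := by
        rw [Finset.sum_comm]
        simp only [← Finset.mul_sum, sum_toReal_pmf, mul_one]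

/-- A mixture of distributions close to `r` is close to `r`. -/
theorem statDist_mixture_le (p : PMF α) (F : α → PMF β) (r : PMF β) {d : ℝ}
    (h : ∀ x, statDist (F x) r ≤ d) : statDist (p.bind F) r ≤ d := by
  rw [statDist_eq_sum]
  calc ∑ y, |(p.bind F y).toReal - (r y).toReal|
      = ∑ y, |∑ x, (p x).toReal * ((F x y).toReal - (r y).toReal)| := by
        refine Finset.sum_congr rfl fun y _ => ?_
        rw [toReal_bind_apply]
        simp only [mul_sub, Finset.sum_sub_distrib, ← Finset.sum_mul, sum_toReal_pmf, one_mul]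
    _ ≤ ∑ y, ∑ x, (p x).toReal * |(F x y).toReal - (r y).toReal| := by
        refine Finset.sum_le_sum fun y _ => (Finset.abs_sum_le_sum_abs _ _).trans_eq ?_
        simp only [abs_mul, ENNReal.abs_toReal]
    _ = ∑ x, (p x).toReal * statDist (F x) r := by
        rw [Finset.sum_comm]
        simp only [← Finset.mul_sum, statDist_eq_sum]
    _ ≤ ∑ x, (p x).toReal * d :=
        Finset.sum_le_sum fun x _ => mul_le_mul_of_nonneg_left (h x) ENNReal.toReal_nonneg
    _ = d := by rw [← Finset.sum_mul, sum_toReal_pmf, one_mul]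

/-- Replacing the factors of a product distribution one at a time. -/
theorem sum_abs_prod_sub_prod_le {p q : α → ℝ} (hp : ∀ x, 0 ≤ p x) (hq : ∀ x, 0 ≤ q x)
    (hp1 : ∑ x, p x = 1) (hq1 : ∑ x, q x = 1) : ∀ m : ℕ,
    ∑ a : Fin m → α, |∏ i, p (a i) - ∏ i, q (a i)| ≤ m * ∑ x, |p x - q x|
  | 0 => by simp
  | m + 1 => by
    classical
    have ih := sum_abs_prod_sub_prod_le hp hq hp1 hq1 m
    have hpm : ∑ a : Fin m → α, ∏ i, p (a i) = 1 := by
      have h := Finset.prod_univ_sum (fun _ : Fin m => (Finset.univ : Finset α)) fun _ a => p a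
      rw [Fintype.piFinset_univ] at h
      rw [← h, hp1, Finset.prod_const_one]
    rw [← (Fin.consEquiv fun _ : Fin (m + 1) => α).sum_comp, Fintype.sum_prod_type]
    simp only [Fin.consEquiv, Equiv.coe_fn_mk, Fin.prod_univ_succ, Fin.cons_zero, Fin.cons_succ]
    calc ∑ x, ∑ a : Fin m → α, |p x * ∏ i, p (a i) - q x * ∏ i, q (a i)|
        ≤ ∑ x, ∑ a : Fin m → α, (|p x - q x| * ∏ i, p (a i) +
            q x * |∏ i, p (a i) - ∏ i, q (a i)|) := by
          refine Finset.sum_le_sum fun x _ => Finset.sum_le_sum fun a _ => ?_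
          have h0 : 0 ≤ ∏ i, p (a i) := Finset.prod_nonneg fun i _ => hp _
          have e : p x * ∏ i, p (a i) - q x * ∏ i, q (a i) =
              (p x - q x) * ∏ i, p (a i) + q x * (∏ i, p (a i) - ∏ i, q (a i)) := by ring
          rw [e]
          refine (abs_add_le _ _).trans_eq ?_
          rw [abs_mul, abs_mul, abs_of_nonneg h0, abs_of_nonneg (hq x)]
      _ = ∑ x, |p x - q x| + ∑ a : Fin m → α, |∏ i, p (a i) - ∏ i, q (a i)| := by
          simp only [Finset.sum_add_distrib, ← Finset.mul_sum, hpm, mul_one]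
          rw [← Finset.sum_mul, hq1, one_mul]
      _ ≤ _ := by push_cast; linarith

theorem toReal_iid_apply (m : ℕ) (p : PMF α) (a : Fin m → α) :
    (iid m p a).toReal = ∏ i, (p (a i)).toReal := by
  rw [iid, PMF.ofFintype_apply, ENNReal.toReal_prod]

theorem statDist_iid_le (m : ℕ) (p q : PMF α) :
    statDist (iid m p) (iid m q) ≤ m * statDist p q := by
  simp only [statDist_eq_sum, toReal_iid_apply]
  exact sum_abs_prod_sub_prod_le (fun _ => ENNReal.toReal_nonneg) (fun _ => ENNReal.toReal_nonneg)
    (sum_toReal_pmf p) (sum_toReal_pmf q) m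

theorem iid_map (m : ℕ) (p : PMF α) (f : α → β) :
    (iid m p).map (fun x i => f (x i)) = iid m (p.map f) := by
  classical
  ext b
  have h1 : ∀ i, p.map f (b i) = ∑ x ∈ Finset.univ.filter (fun x => f x = b i), p x := fun i => by
    rw [PMF.map_apply, tsum_fintype, Finset.sum_filter]
    exact Finset.sum_congr rfl fun x _ => by simp only [eq_comm]
  rw [iid, iid, PMF.ofFintype_apply, PMF.map_apply, tsum_fintype]
  simp only [h1, PMF.ofFintype_apply]
  rw [Finset.prod_univ_sum]
  have h2 := Finset.sum_filter (s := Finset.univ) (fun x : Fin m → α => b = fun i => f (x i))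
    fun x => ∏ i, p (x i)
  refine (Eq.trans ?_ h2.symm).trans ?_
  · exact Finset.sum_congr rfl fun x _ => by congr
  refine Finset.sum_congr ?_ fun _ _ => rfl
  ext a
  simp only [Finset.mem_filter, Finset.mem_univ, true_and, Fintype.mem_piFinset, funext_iff]
  exact forall_congr' fun i => eq_comm

end StatDist

/-! ### The coefficient of a sample -/

theorem toReal_mulVec_intCast {n : ℕ} (B : Matrix (Fin n) (Fin n) ℤ) (y : Fin n → ℤ) (i : Fin n) :
    (toReal B *ᵥ fun i => (y i : ℝ)) i = ((B *ᵥ y) i : ℤ) := by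
  simp [Matrix.mulVec, dotProduct, toReal]

theorem IsSNF.mulVec {n N : ℕ} [NeZero n] {B : Matrix (Fin n) (Fin n) ℤ}
    (hB : IsSNF N B) (y : Fin n → ℤ) (i : Fin n) :
    (B *ᵥ y) i = if i = 0 then N * y 0 + ∑ j ∈ Finset.univ.erase 0, B 0 j * y j else y i := by
  simp only [Matrix.mulVec, dotProduct]
  split_ifs with hi
  · subst hi
    rw [← Finset.add_sum_erase _ _ (Finset.mem_univ 0), hB.corner]
  · rw [Finset.sum_eq_single i]
    · rw [hB.diag i hi, one_mul]
    · intro j _ hj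
      rw [hB.off i j hi hj.symm, zero_mul]
    · simp

theorem snfResidue_eq {n N : ℕ} [NeZero n] (B : Matrix (Fin n) (Fin n) ℤ) (x : Fin n → ZMod N) :
    snfResidue N B x = x 0 - ∑ j ∈ Finset.univ.erase 0, (B 0 j : ZMod N) * x j := by
  rw [snfResidue, ← Finset.add_sum_erase _ _ (Finset.mem_univ 0), sub_eq_add_neg,
    ← Finset.sum_neg_distrib]
  congr 1
  · simp [snfForm]
  · refine Finset.sum_congr rfl fun j hj => ?_
    simp [snfForm, Finset.ne_of_mem_erase hj]

theorem IsSNF.mem_latticeMod_iff {n N : ℕ} [NeZero n] [NeZero N]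
    {B : Matrix (Fin n) (Fin n) ℤ} (hB : IsSNF N B) (z : Fin n → ZMod N) :
    z ∈ latticeMod N B ↔ snfResidue N B z = 0 := by
  have hmem : z ∈ latticeMod N B ↔ ∃ y : Fin n → ℤ, ∀ i, ((z i).val : ℤ) = (B *ᵥ y) i := by
    refine exists_congr fun y => ?_
    rw [funext_iff]
    refine forall_congr' fun i => ?_
    rw [toReal_mulVec_intCast, rep]
    norm_cast
  have hval : ∀ i, (((z i).val : ℤ) : ZMod N) = z i := fun i => by simp
  rw [hmem, snfResidue_eq]
  constructor
  · rintro ⟨y, hy⟩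
    have h0 := congrArg (fun a : ℤ => (a : ZMod N)) (hy 0)
    simp only [hval, hB.mulVec, if_true] at h0
    rw [h0]
    push_cast
    rw [ZMod.natCast_self, zero_mul, zero_add, sub_eq_zero]
    refine Finset.sum_congr rfl fun j hj => ?_
    have := congrArg (fun a : ℤ => (a : ZMod N)) (hy j)
    simp only [hval, hB.mulVec, if_neg (Finset.ne_of_mem_erase hj)] at this
    rw [this]
  · intro h
    have h1 : (((z 0).val - ∑ j ∈ Finset.univ.erase 0, B 0 j * (z j).val : ℤ) : ZMod N) = 0 := by
      push_cast
      simpa using h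
    obtain ⟨q, hq⟩ := (ZMod.intCast_zmod_eq_zero_iff_dvd _ N).mp h1
    refine ⟨fun i => if i = 0 then q else (z i).val, fun i => ?_⟩
    rw [hB.mulVec]
    by_cases hi : i = 0
    · simp only [hi, if_true]
      have : ∑ j ∈ Finset.univ.erase 0, B 0 j * (if j = 0 then q else ((z j).val : ℤ)) =
          ∑ j ∈ Finset.univ.erase 0, B 0 j * ((z j).val : ℤ) :=
        Finset.sum_congr rfl fun j hj => by rw [if_neg (Finset.ne_of_mem_erase hj)]
      rw [this]
      linarith
    · simp [hi]

/-- `(N L^*)_N` is the line spanned by `snfForm B`. -/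
theorem IsSNF.mem_scaledDualMod_iff {n N : ℕ} [NeZero n] [NeZero N]
    {B : Matrix (Fin n) (Fin n) ℤ} (hB : IsSNF N B) (z : Fin n → ZMod N) :
    z ∈ scaledDualMod N B ↔ z = fun i => z 0 * (snfForm B i : ZMod N) := by
  have hN : (N : ℝ) ≠ 0 := by exact_mod_cast NeZero.ne N
  have hdet : IsUnit ((toReal B)ᵀ).det := by
    rw [Matrix.det_transpose, det_toReal, hB.det_eq, isUnit_iff_ne_zero]
    exact_mod_cast hN
  have hmem : z ∈ scaledDualMod N B ↔
      ∃ y : Fin n → ℤ, ∀ i, ((toReal B)ᵀ *ᵥ rep z) i = N * (y i : ℝ) := by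
    refine exists_congr fun y => ?_
    rw [Matrix.transpose_nonsing_inv, Matrix.smul_mulVec]
    constructor
    · intro h i
      rw [h, Matrix.mulVec_smul, Matrix.mulVec_mulVec, Matrix.mul_nonsing_inv _ hdet,
        Matrix.one_mulVec]
      rfl
    · intro h
      have h' : (toReal B)ᵀ *ᵥ rep z = (N : ℝ) • fun i => (y i : ℝ) := funext h
      rw [← Matrix.mulVec_smul, ← h', Matrix.mulVec_mulVec, Matrix.nonsing_inv_mul _ hdet,
        Matrix.one_mulVec]
  have hval : ∀ i, (((z i).val : ℤ) : ZMod N) = z i := fun i => by simp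
  rw [hmem, funext_iff]
  constructor
  · rintro ⟨y, hy⟩ i
    by_cases hi : i = 0
    · simp [hi, snfForm]
    · have h := hy i
      rw [hB.transpose_mulVec, if_neg hi, rep, rep] at h
      have h1 : B 0 i * ((z 0).val : ℤ) + ((z i).val : ℤ) = N * y i := by exact_mod_cast h
      have h2 := congrArg (fun a : ℤ => (a : ZMod N)) h1
      push_cast [hval] at h2
      rw [ZMod.natCast_self, zero_mul] at h2
      simp only [snfForm, hi, if_false]
      push_cast
      linear_combination h2
  · intro h
    have : ∀ i, ∃ c : ℤ, ((toReal B)ᵀ *ᵥ rep z) i = N * (c : ℝ) := fun i => by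
      rw [hB.transpose_mulVec]
      by_cases hi : i = 0
      · exact ⟨(z 0).val, by simp [hi, rep]⟩
      · have h1 : ((B 0 i * ((z 0).val : ℤ) + ((z i).val : ℤ) : ℤ) : ZMod N) = 0 := by
          push_cast
          simp only [ZMod.natCast_val, ZMod.cast_id', id]
          rw [h i]
          simp only [snfForm, hi, if_false]
          push_cast
          ring
        obtain ⟨q, hq⟩ := (ZMod.intCast_zmod_eq_zero_iff_dvd _ N).mp h1
        refine ⟨q, ?_⟩
        rw [if_neg hi, rep, rep]
        exact_mod_cast hq
    choose y hy using this
    exact ⟨y, hy⟩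

/-- The coefficient of `x` depends only on the class of `x` modulo the lattice. If the denominator
vanishes, then the correcting point is never unique and both sides are `0`. -/
theorem IsSNF.dualPoint_zero {n N : ℕ} [NeZero n] [Fact N.Prime]
    {B : Matrix (Fin n) (Fin n) ℤ} (hB : IsSNF N B) (x : Fin n → ZMod N) :
    dualPoint N B x 0 =
      -snfResidue N B x / snfResidue N B fun i => (snfForm B i : ZMod N) := by
  classical
  set w : Fin n → ZMod N := fun i => (snfForm B i : ZMod N) with hw
  have hw0 : w 0 = 1 := by simp [hw, snfForm]
  have hmem : ∀ y, (y ∈ scaledDualMod N B ∧ x + y ∈ latticeMod N B) ↔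
      y = (fun i => y 0 * w i) ∧ snfResidue N B x + y 0 * snfResidue N B w = 0 := fun y => by
    rw [hB.mem_scaledDualMod_iff, hB.mem_latticeMod_iff]
    refine and_congr_right fun hy => ?_
    have : snfResidue N B (x + y) = snfResidue N B x + y 0 * snfResidue N B w := by
      simp only [snfResidue, Finset.mul_sum, ← Finset.sum_add_distrib]
      refine Finset.sum_congr rfl fun i _ => ?_
      rw [Pi.add_apply, congrFun hy i]
      ring
    rw [this]
  by_cases hW : snfResidue N B w = 0
  · have hno : ¬∃! y, y ∈ scaledDualMod N B ∧ x + y ∈ latticeMod N B := by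
      rintro ⟨y, hy, huniq⟩
      obtain ⟨h1, h2⟩ := (hmem y).mp hy
      have h3 := huniq (fun i => (y 0 + 1) * w i) ((hmem _).mpr (by
        refine ⟨by simp [hw0], ?_⟩
        rw [hW] at h2 ⊢
        simpa using h2))
      have h4 := congrFun h3 0
      simp [hw0] at h4
    rw [dualPoint, dif_neg hno, hW, div_zero]
    rfl
  · have hyes : ∃! y, y ∈ scaledDualMod N B ∧ x + y ∈ latticeMod N B := by
      refine ⟨fun i => (-snfResidue N B x / snfResidue N B w) * w i, (hmem _).mpr ?_,
        fun y hy => ?_⟩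
      · refine ⟨by simp [hw0], ?_⟩
        simp only [hw0]
        field_simp
        ring
      · obtain ⟨h1, h2⟩ := (hmem y).mp hy
        rw [h1]
        funext i
        congr 1
        rw [eq_div_iff hW]
        linear_combination h2
    rw [dualPoint, dif_pos hyes]
    obtain ⟨h1, h2⟩ := (hmem _).mp hyes.choose_spec.1
    rw [eq_div_iff hW]
    linear_combination h2

/-- If the Gaussian parameter exceeds the smoothing parameter, then the oracle's answer hardly
depends on the guess. -/
theorem IsSNF.statDist_coefficientLaw_le {n m N : ℕ} [NeZero n] [Fact N.Prime]
    {B : Matrix (Fin n) (Fin n) ℤ} (hB : IsSNF N B) {s ε : ℝ} (hs : 0 < s) (hε : 0 ≤ ε)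
    (hε1 : ε < 1) (h : dualGaussSum (toReal B) s ≤ ENNReal.ofReal ε) (T : ℕ) (vhat : Fin n → ℝ)
    (A : (Fin m → ZMod N) → PMF (Option (Fin m → ZMod N))) (c₁ c₂ : ZMod N) :
    statDist (coefficientLaw B T s vhat A c₁) (coefficientLaw B T s vhat A c₂) ≤
      2 * (m * (ε / (1 - ε))) := by
  classical
  set f : ZMod N → ZMod N := fun r => -r / snfResidue N B fun i => (snfForm B i : ZMod N)
  set A' : (Fin m → ZMod N) → PMF (Option (Fin m → ZMod N)) := fun r => A fun i => f (r i)
  set ref := (iid m (PMF.uniformOfFintype (ZMod N))).bind A'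
  have key : ∀ c, statDist (coefficientLaw B T s vhat A c) ref ≤ m * (ε / (1 - ε)) := fun c => by
    refine statDist_mixture_le _ _ _ fun u => ?_
    have e : ((iid m (gaussianMod N s (vTarget T vhat c u))).bind fun x =>
        A fun i => dualPoint N B (x i) 0) =
        (iid m ((gaussianMod N s (vTarget T vhat c u)).map (snfResidue N B))).bind A' := by
      rw [← iid_map, PMF.bind_map]
      simp only [hB.dualPoint_zero]
      rfl
    rw [e]
    refine (statDist_bind_le _ _ _).trans ((statDist_iid_le _ _ _).trans ?_)
    refine mul_le_mul_of_nonneg_left ?_ (Nat.cast_nonneg m)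
    rw [gaussianMod, dif_pos hs, PMF.map_comp, statDist_eq_sum]
    refine le_trans (le_of_eq (Finset.sum_congr rfl fun a _ => ?_))
      (hB.sum_abs_residue_sub_le hs hε hε1 h (vTarget T vhat c u))
    rw [PMF.uniformOfFintype_apply, ZMod.card, ENNReal.toReal_inv, ENNReal.toReal_natCast, one_div]
    rfl
  have h1 := statDist_le_add (coefficientLaw B T s vhat A c₁) (coefficientLaw B T s vhat A c₂) ref
  linarith [key c₁, key c₂]

/-! ### Bases of the same lattice, up to isometry -/

/-- The sum in the definition of the smoothing parameter, over integer coordinates. -/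
theorem tsum_dualLattice_eq {n : ℕ} {A : Matrix (Fin n) (Fin n) ℝ} (hA : A.det ≠ 0) (s : ℝ) :
    ∑' w : {w : Fin n → ℝ // w ∈ dualLattice A ∧ w ≠ 0},
      ENNReal.ofReal (rho (1 / s) 0 w.1) = dualGaussSum A s := by
  classical
  have hdet : IsUnit (Aᵀ).det := by rwa [Matrix.det_transpose, isUnit_iff_ne_zero]
  have hinj : ∀ z z' : Fin n → ℤ, (A⁻¹)ᵀ *ᵥ (fun i => (z i : ℝ)) = (A⁻¹)ᵀ *ᵥ (fun i => (z' i : ℝ)) →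
      z = z' := fun z z' h => by
    have h1 := congrArg (Aᵀ *ᵥ ·) h
    simp only [Matrix.mulVec_mulVec, Matrix.transpose_nonsing_inv, Matrix.mul_nonsing_inv _ hdet,
      Matrix.one_mulVec] at h1
    exact funext fun i => by exact_mod_cast congrFun h1 i
  have h0 : (A⁻¹)ᵀ *ᵥ (fun i => ((0 : Fin n → ℤ) i : ℝ)) = 0 := by
    have : (fun i => ((0 : Fin n → ℤ) i : ℝ)) = 0 := by funext i; simp
    rw [this, Matrix.mulVec_zero]
  let e : {z : Fin n → ℤ // z ≠ 0} → {w : Fin n → ℝ // w ∈ dualLattice A ∧ w ≠ 0} := fun z =>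
    ⟨(A⁻¹)ᵀ *ᵥ fun i => (z.1 i : ℝ), ⟨z.1, rfl⟩, fun h => z.2 (hinj _ _ (h.trans h0.symm))⟩
  have he : Function.Bijective e := by
    constructor
    · intro z z' h
      exact Subtype.ext (hinj _ _ (congrArg Subtype.val h))
    · rintro ⟨w, ⟨z, rfl⟩, hw⟩
      refine ⟨⟨z, ?_⟩, rfl⟩
      rintro rfl
      exact hw h0
  rw [← (Equiv.ofBijective e he).tsum_eq, dualGaussSum]
  have := tsum_subtype {z : Fin n → ℤ | z ≠ 0} fun z =>
    ENNReal.ofReal (rho (1 / s) 0 ((A⁻¹)ᵀ *ᵥ fun i => (z i : ℝ)))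
  refine this.trans (tsum_congr fun z => ?_)
  by_cases hz : z = 0 <;> simp [hz]

theorem toReal_mul {n : ℕ} (A B : Matrix (Fin n) (Fin n) ℤ) :
    toReal (A * B) = toReal A * toReal B :=
  Matrix.map_mul (f := Int.castRingHom ℝ)

theorem toReal_one {n : ℕ} : toReal (1 : Matrix (Fin n) (Fin n) ℤ) = 1 :=
  Matrix.map_one _ (by simp) (by simp)

theorem dualGaussSum_mul_GL {n : ℕ} (A : Matrix (Fin n) (Fin n) ℝ) (U : GL (Fin n) ℤ) (s : ℝ) :
    dualGaussSum (A * toReal (U : Matrix (Fin n) (Fin n) ℤ)) s = dualGaussSum A s := by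
  set V : Matrix (Fin n) (Fin n) ℤ := U.val with hV
  set V' : Matrix (Fin n) (Fin n) ℤ := (U⁻¹).val with hV'
  have h1 : V * V' = 1 := by simp [hV, hV']
  have h2 : V' * V = 1 := by simp [hV, hV']
  let e : (Fin n → ℤ) ≃ (Fin n → ℤ) :=
    { toFun := fun z => Vᵀ *ᵥ z
      invFun := fun z => V'ᵀ *ᵥ z
      left_inv := fun z => by
        simp only [Matrix.mulVec_mulVec, ← Matrix.transpose_mul, h1, Matrix.transpose_one,
          Matrix.one_mulVec]
      right_inv := fun z => by
        simp only [Matrix.mulVec_mulVec, ← Matrix.transpose_mul, h2, Matrix.transpose_one,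
          Matrix.one_mulVec] }
  have hinv : (toReal V)⁻¹ = toReal V' := by
    rw [Matrix.inv_eq_right_inv]
    rw [← toReal_mul, h1, toReal_one]
  rw [dualGaussSum, ← e.tsum_eq, dualGaussSum]
  refine tsum_congr fun z => ?_
  have hz : e z = 0 ↔ z = 0 := by
    have : e 0 = 0 := by simp [e]
    conv_lhs => rw [← this]
    exact e.injective.eq_iff
  have hvec : (fun i => (e z i : ℝ)) = (toReal V)ᵀ *ᵥ fun i => (z i : ℝ) := by
    funext i
    simp [e, Matrix.mulVec, dotProduct, toReal]
  have hone : (toReal V')ᵀ * (toReal V)ᵀ = 1 := by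
    rw [← Matrix.transpose_mul, ← toReal_mul, h1, toReal_one, Matrix.transpose_one]
  simp only [hz, hvec, Matrix.mul_inv_rev, hinv, Matrix.transpose_mul, Matrix.mulVec_mulVec,
    Matrix.mul_assoc, hone, Matrix.mul_one]

theorem euclNorm_mulVec_orthogonal {n : ℕ} {Q : Matrix (Fin n) (Fin n) ℝ}
    (hQ : Q ∈ Matrix.orthogonalGroup (Fin n) ℝ) (x : Fin n → ℝ) :
    euclNorm (Q *ᵥ x) = euclNorm x := by
  have h : ∀ y : Fin n → ℝ, ∑ i, y i ^ 2 = y ⬝ᵥ y := fun y => by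
    simp only [dotProduct, sq]
  have hQ' : Qᵀ * Q = 1 := (Matrix.mem_orthogonalGroup_iff' (Fin n) ℝ).mp hQ
  rw [euclNorm, euclNorm, h, h, Matrix.dotProduct_mulVec, Matrix.vecMul_mulVec, hQ',
    Matrix.vecMul_one]

theorem dualGaussSum_orthogonal_mul {n : ℕ} {Q : Matrix (Fin n) (Fin n) ℝ}
    (hQ : Q ∈ Matrix.orthogonalGroup (Fin n) ℝ) (R : Matrix (Fin n) (Fin n) ℝ) (s : ℝ) :
    dualGaussSum (Q * R) s = dualGaussSum R s := by
  have hQ' : Q⁻¹ = Qᵀ :=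
    Matrix.inv_eq_left_inv ((Matrix.mem_orthogonalGroup_iff' (Fin n) ℝ).mp hQ)
  refine tsum_congr fun z => ?_
  rw [Matrix.mul_inv_rev, hQ', Matrix.transpose_mul, Matrix.transpose_transpose,
    ← Matrix.mulVec_mulVec, rho_one_div, rho_one_div, euclNorm_mulVec_orthogonal hQ]

theorem abs_det_GL {n : ℕ} (U : GL (Fin n) ℤ) : |(U : Matrix (Fin n) (Fin n) ℤ).det| = 1 := by
  rw [← Int.isUnit_iff_abs_eq]
  exact (Matrix.isUnit_iff_isUnit_det _).mp U.isUnit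

theorem abs_det_orthogonal {n : ℕ} {Q : Matrix (Fin n) (Fin n) ℝ}
    (hQ : Q ∈ Matrix.orthogonalGroup (Fin n) ℝ) : |Q.det| = 1 := by
  have h := congrArg Matrix.det ((Matrix.mem_orthogonalGroup_iff' (Fin n) ℝ).mp hQ)
  rw [Matrix.det_one, Matrix.det_mul, Matrix.det_transpose] at h
  rw [← sq_eq_sq₀ (abs_nonneg _) zero_le_one, sq_abs, one_pow, sq, h]

/-! ### Estimates for LLL-reduced bases -/

theorem euclNorm_nonneg {n : ℕ} (x : Fin n → ℝ) : 0 ≤ euclNorm x := Real.sqrt_nonneg _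

theorem euclNorm_eq_norm {n : ℕ} (x : Fin n → ℝ) :
    euclNorm x = ‖(WithLp.toLp 2 x : EuclideanSpace ℝ (Fin n))‖ := by
  rw [EuclideanSpace.norm_eq, euclNorm]
  simp

theorem euclNorm_add_le {n : ℕ} (x y : Fin n → ℝ) : euclNorm (x + y) ≤ euclNorm x + euclNorm y := by
  simp only [euclNorm_eq_norm, WithLp.toLp_add]
  exact norm_add_le _ _

theorem euclNorm_smul {n : ℕ} (a : ℝ) (x : Fin n → ℝ) : euclNorm (a • x) = |a| * euclNorm x := by
  simp only [euclNorm_eq_norm, WithLp.toLp_smul, norm_smul, Real.norm_eq_abs]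

theorem abs_le_euclNorm {n : ℕ} (x : Fin n → ℝ) (i : Fin n) : |x i| ≤ euclNorm x := by
  refine Real.abs_le_sqrt ?_
  exact Finset.single_le_sum (f := fun i => x i ^ 2) (fun i _ => sq_nonneg _) (Finset.mem_univ i)

theorem euclNorm_le_sum {n : ℕ} (x : Fin n → ℝ) : euclNorm x ≤ ∑ i, |x i| := by
  refine (Real.sqrt_le_left (Finset.sum_nonneg fun i _ => abs_nonneg _)).mpr ?_
  simp_rw [← sq_abs (x _)]
  exact Finset.sum_sq_le_sq_sum_of_nonneg fun i _ => abs_nonneg _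

theorem euclNorm_le_mul {n : ℕ} {x : Fin n → ℝ} {M : ℝ} (h : ∀ i, |x i| ≤ M) :
    euclNorm x ≤ n * M := by
  refine (euclNorm_le_sum x).trans ((Finset.sum_le_sum fun i _ => h i).trans_eq ?_)
  simp

theorem natCast_le_two_pow (n : ℕ) : (n : ℝ) ≤ 2 ^ n := by
  exact_mod_cast (Nat.lt_two_pow_self (n := n)).le

namespace IsLLLReduced

variable {n : ℕ} {R : Matrix (Fin n) (Fin n) ℝ} (hR : IsLLLReduced R)
include hR

theorem det_eq : R.det = ∏ i, R i i :=
  Matrix.det_of_isUpperTriangular fun i j hij => hR.upper i j hij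

theorem diag_ne_zero (hdet : R.det ≠ 0) (i : Fin n) : R i i ≠ 0 := by
  rw [hR.det_eq, Finset.prod_ne_zero_iff] at hdet
  exact hdet i (Finset.mem_univ i)

theorem abs_diag_le_succ {i j : Fin n} (hij : (i : ℕ) + 1 = j) : |R i i| ≤ 2 * |R j j| := by
  have h1 := hR.lovasz i j hij
  have h2 := hR.size_reduced i j (Fin.lt_def.mpr (by omega))
  have h3 : R i j ^ 2 ≤ (|R i i| / 2) ^ 2 := sq_le_sq.mpr (by rwa [abs_of_nonneg (a := |R i i| / 2)
    (by positivity)])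
  rw [div_pow, sq_abs] at h3
  refine abs_le_of_sq_le_sq' ?_ (by positivity) |>.2
  rw [mul_pow, sq_abs, sq_abs]
  nlinarith [sq_nonneg (R i i), sq_nonneg (R j j)]

theorem abs_diag_le_pow {i j : Fin n} (hij : i ≤ j) : |R i i| ≤ 2 ^ n * |R j j| := by
  have key : ∀ k : ℕ, ∀ j : Fin n, (j : ℕ) = i + k → |R i i| ≤ 2 ^ k * |R j j| := by
    intro k
    induction k with
    | zero =>
      intro j hj
      have : j = i := Fin.ext (by simpa using hj)
      rw [this]; simp
    | succ k ih =>
      intro j hj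
      have hlt : (i : ℕ) + k < n := by have := j.2; omega
      have h1 := ih ⟨i + k, hlt⟩ rfl
      have h2 := hR.abs_diag_le_succ (i := ⟨i + k, hlt⟩) (j := j) (by simp only; omega)
      calc _ ≤ _ := h1
        _ ≤ 2 ^ k * (2 * |R j j|) := by gcongr
        _ = _ := by ring
  obtain ⟨k, hk⟩ := Nat.exists_eq_add_of_le (Fin.le_def.mp hij)
  refine (key k j hk).trans ?_
  gcongr
  · norm_num
  · have := j.2; omega

/-- Forward substitution: a bound for the solution of a linear system with the transpose of an
LLL-reduced basis. -/
theorem abs_diag_mul_le {g : Fin n → ℝ} {Y : ℝ} (hY : ∀ i, |(Rᵀ *ᵥ g) i| ≤ Y) (j : Fin n) :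
    |R j j * g j| ≤ 2 ^ (j : ℕ) * Y := by
  induction j using WellFoundedLT.induction with
  | ind j ih =>
    have hsum : (Rᵀ *ᵥ g) j = R j j * g j + ∑ i ∈ Finset.Iio j, R i j * g i := by
      have h1 : (Rᵀ *ᵥ g) j = ∑ i, R i j * g i := by simp [Matrix.mulVec, dotProduct]
      rw [h1, ← Finset.sum_subset (Finset.subset_univ (Finset.Iic j)), ← Finset.Iio_insert,
        Finset.sum_insert (by simp)]
      intro i _ hi
      rw [hR.upper i j (by simpa using hi), zero_mul]
    have hrest : |∑ i ∈ Finset.Iio j, R i j * g i| ≤ (2 ^ (j : ℕ) - 1) * Y / 2 := by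
      refine (Finset.abs_sum_le_sum_abs _ _).trans ?_
      have hgeom : ∑ i ∈ Finset.Iio j, (2 : ℝ) ^ (i : ℕ) = 2 ^ (j : ℕ) - 1 := by
        have h1 : ∑ k ∈ Finset.Iio (j : ℕ), (2 : ℝ) ^ k =
            ∑ i ∈ Finset.Iio j, (2 : ℝ) ^ (i : ℕ) := by
          rw [← Fin.map_valEmbedding_Iio, Finset.sum_map]
          rfl
        rw [← h1, Nat.Iio_eq_range, geom_sum_eq (by norm_num)]
        norm_num
      rw [← hgeom, Finset.sum_mul, Finset.sum_div]
      refine Finset.sum_le_sum fun i hi => ?_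
      have hij : i < j := Finset.mem_Iio.mp hi
      have h1 := ih i hij
      rw [abs_mul] at h1 ⊢
      have h2 := mul_le_mul_of_nonneg_right (hR.size_reduced i j hij) (abs_nonneg (g i))
      linarith
    have h3 := hY j
    have hY0 : 0 ≤ Y := (abs_nonneg _).trans h3
    have h4 : R j j * g j = (Rᵀ *ᵥ g) j - ∑ i ∈ Finset.Iio j, R i j * g i := by rw [hsum]; ring
    rw [h4]
    refine (abs_sub _ _).trans ?_
    have h5 : (1 : ℝ) ≤ 2 ^ (j : ℕ) := one_le_pow₀ (by norm_num)
    nlinarith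

theorem eq_zero_of_mulVec_eq_zero (hdet : R.det ≠ 0) {g : Fin n → ℝ} {i : Fin n}
    (h0 : ∀ k < i, (Rᵀ *ᵥ g) k = 0) (j : Fin n) (hj : j < i) : g j = 0 := by
  induction j using WellFoundedLT.induction with
  | ind j ih =>
    have hsum : (Rᵀ *ᵥ g) j = R j j * g j := by
      have h1 : (Rᵀ *ᵥ g) j = ∑ i, R i j * g i := by simp [Matrix.mulVec, dotProduct]
      rw [h1, Finset.sum_eq_single j]
      · intro k _ hk
        rcases lt_or_gt_of_ne hk with hlt | hgt
        · rw [ih k hlt (hlt.trans hj), mul_zero]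
        · rw [hR.upper k j hgt, zero_mul]
      · simp
    have := h0 j hj
    rw [hsum] at this
    exact (mul_eq_zero.mp this).resolve_left (hR.diag_ne_zero hdet j)

/-- Dual vectors are short: a solution of a triangular system whose right side vanishes before the
index `i` is bounded in terms of `R i i`, the diagonal decreasing at most geometrically. -/
theorem euclNorm_mul_diag_le (hdet : R.det ≠ 0) {g : Fin n → ℝ} {Y : ℝ} {i : Fin n}
    (hY : ∀ j, |(Rᵀ *ᵥ g) j| ≤ Y) (h0 : ∀ k < i, (Rᵀ *ᵥ g) k = 0) :
    euclNorm g * |R i i| ≤ 8 ^ n * Y := by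
  have hY0 : 0 ≤ Y := (abs_nonneg _).trans (hY i)
  have hRi : 0 < |R i i| := abs_pos.mpr (hR.diag_ne_zero hdet i)
  have hg : ∀ j, |g j| ≤ 2 ^ n * 2 ^ n * Y / |R i i| := fun j => by
    rw [le_div_iff₀ hRi]
    rcases lt_or_ge j i with hlt | hge
    · rw [hR.eq_zero_of_mulVec_eq_zero hdet h0 j hlt, abs_zero, zero_mul]
      positivity
    · have h1 := hR.abs_diag_mul_le hY j
      rw [abs_mul] at h1
      calc |g j| * |R i i| ≤ |g j| * (2 ^ n * |R j j|) := by
            gcongr; exact hR.abs_diag_le_pow hge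
        _ = 2 ^ n * (|R j j| * |g j|) := by ring
        _ ≤ 2 ^ n * (2 ^ (j : ℕ) * Y) := by gcongr
        _ ≤ 2 ^ n * (2 ^ n * Y) := by
            gcongr
            · norm_num
            · exact j.2.le
        _ = _ := by ring
  calc euclNorm g * |R i i| ≤ n * (2 ^ n * 2 ^ n * Y / |R i i|) * |R i i| := by
        gcongr; exact euclNorm_le_mul hg
    _ = n * (2 ^ n * 2 ^ n * Y) := by field_simp
    _ ≤ 2 ^ n * (2 ^ n * 2 ^ n * Y) := by
        gcongr; exact natCast_le_two_pow n
    _ = (2 * 2 * 2) ^ n * Y := by rw [mul_pow, mul_pow]; ring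
    _ = _ := by norm_num

/-- Dual vectors are not too short, if `η` is comparable to the largest diagonal entry. -/
theorem sum_sq_mulVec_le {η : ℝ} (hη : ∀ i, |R i i| ≤ 8 ^ n * η) (w : Fin n → ℝ) :
    ∑ j, (Rᵀ *ᵥ w) j ^ 2 ≤ 512 ^ n * (η ^ 2 * euclNorm w ^ 2) := by
  have hentry : ∀ i j, |R i j| ≤ 8 ^ n * η := fun i j => by
    rcases lt_trichotomy i j with h | h | h
    · have := hR.size_reduced i j h
      linarith [hη i, abs_nonneg (R i i)]
    · rw [← h]; exact hη i
    · rw [hR.upper i j h, abs_zero]; exact (abs_nonneg _).trans (hη i)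
  have hj : ∀ j, (Rᵀ *ᵥ w) j ^ 2 ≤ (n * (8 ^ n * η * euclNorm w)) ^ 2 := fun j => by
    rw [← sq_abs]
    refine pow_le_pow_left₀ (abs_nonneg _) ?_ 2
    have h1 : (Rᵀ *ᵥ w) j = ∑ i, R i j * w i := by simp [Matrix.mulVec, dotProduct]
    rw [h1]
    refine (Finset.abs_sum_le_sum_abs _ _).trans ?_
    refine (Finset.sum_le_sum fun i _ => ?_).trans_eq (b := ∑ _i : Fin n, 8 ^ n * η * euclNorm w)
      (by simp)
    rw [abs_mul]
    exact mul_le_mul (hentry i j) (abs_le_euclNorm w i) (abs_nonneg _)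
      ((abs_nonneg _).trans (hentry i j))
  refine (Finset.sum_le_sum fun j _ => hj j).trans ?_
  rw [Finset.sum_const, Finset.card_univ, Fintype.card_fin, nsmul_eq_mul]
  calc (n : ℝ) * (n * (8 ^ n * η * euclNorm w)) ^ 2
      = n * n * n * ((8 ^ n) ^ 2 * (η ^ 2 * euclNorm w ^ 2)) := by ring
    _ ≤ 2 ^ n * 2 ^ n * 2 ^ n * ((8 ^ n) ^ 2 * (η ^ 2 * euclNorm w ^ 2)) := by
        gcongr <;> exact natCast_le_two_pow n
    _ = (2 * 2 * 2 * 8 * 8) ^ n * (η ^ 2 * euclNorm w ^ 2) := by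
        simp only [mul_pow]; ring
    _ = _ := by norm_num

end IsLLLReduced

/-! ### The smoothing parameter of an LLL-reduced basis -/

theorem tsum_exp_neg_mul_int_sq_le {β : ℝ} (hβ : 0 < β) :
    ∑' k : ℤ, ENNReal.ofReal (Real.exp (-β * (k : ℝ) ^ 2)) ≤ ENNReal.ofReal (2 + 2 / β) := by
  set r := Real.exp (-β) with hr
  have hr0 : 0 < r := Real.exp_pos _
  have hr1 : r < 1 := by rw [hr, ← Real.exp_zero]; exact Real.exp_lt_exp.mpr (by linarith)
  have hgeom := hasSum_geometric_of_lt_one hr0.le hr1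
  have h1 : HasSum (fun k : ℤ => r ^ k.natAbs) ((1 - r)⁻¹ + r * (1 - r)⁻¹) := by
    refine HasSum.of_nat_of_neg_add_one (f := fun k : ℤ => r ^ k.natAbs) (by simpa using hgeom) ?_
    refine (hgeom.mul_left r).congr_fun fun k => ?_
    have : (-((k : ℤ) + 1)).natAbs = k + 1 := by omega
    rw [this, pow_succ']
  have h2 : ∀ k : ℤ, Real.exp (-β * (k : ℝ) ^ 2) ≤ r ^ k.natAbs := fun k => by
    rw [hr, ← Real.exp_nat_mul]
    refine Real.exp_le_exp.mpr ?_
    have h3 : ((k.natAbs : ℕ) : ℝ) ≤ (k : ℝ) ^ 2 := by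
      have h4 : k.natAbs ≤ k.natAbs ^ 2 := Nat.le_self_pow (by norm_num) _
      calc ((k.natAbs : ℕ) : ℝ) ≤ (k.natAbs : ℝ) ^ 2 := by exact_mod_cast h4
        _ = (k : ℝ) ^ 2 := by rw [Nat.cast_natAbs, Int.cast_abs, sq_abs]
    nlinarith
  calc ∑' k : ℤ, ENNReal.ofReal (Real.exp (-β * (k : ℝ) ^ 2))
      ≤ ∑' k : ℤ, ENNReal.ofReal (r ^ k.natAbs) :=
        ENNReal.tsum_le_tsum fun k => ENNReal.ofReal_le_ofReal (h2 k)
    _ = ENNReal.ofReal ((1 - r)⁻¹ + r * (1 - r)⁻¹) := by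
        rw [← ENNReal.ofReal_tsum_of_nonneg (fun k => by positivity) h1.summable, h1.tsum_eq]
    _ ≤ _ := by
        refine ENNReal.ofReal_le_ofReal ?_
        have h4 : r * (1 + β) ≤ 1 := by
          have h5 : 1 + β ≤ Real.exp β := by linarith [Real.add_one_le_exp β]
          calc r * (1 + β) ≤ r * Real.exp β := by gcongr
            _ = 1 := by rw [hr, ← Real.exp_add]; simp
        have h6 : (1 - r)⁻¹ + r * (1 - r)⁻¹ = (1 + r) / (1 - r) := by
          rw [div_eq_mul_inv]; ring
        have h7 : 2 + 2 / β = (2 * β + 2) / β := by field_simp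
        rw [h6, h7, div_le_div_iff₀ (by linarith) hβ]
        nlinarith

theorem tsum_exp_neg_mul_sum_sq_le {n : ℕ} {β : ℝ} (hβ : 0 < β) :
    ∑' z : Fin n → ℤ, ENNReal.ofReal (Real.exp (-β * ∑ i, (z i : ℝ) ^ 2)) ≤
      ENNReal.ofReal ((2 + 2 / β) ^ n) := by
  have h : ∀ z : Fin n → ℤ, ENNReal.ofReal (Real.exp (-β * ∑ i, (z i : ℝ) ^ 2)) =
      ∏ i, ENNReal.ofReal (Real.exp (-β * (z i : ℝ) ^ 2)) := fun z => by
    rw [← ENNReal.ofReal_prod_of_nonneg fun i _ => (Real.exp_pos _).le, ← Real.exp_sum,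
      Finset.mul_sum]
  rw [tsum_congr h, tsum_pi_prod (fun (_ : Fin n) (k : ℤ) =>
    ENNReal.ofReal (Real.exp (-β * (k : ℝ) ^ 2))), Finset.prod_const, Finset.card_univ,
    Fintype.card_fin, ENNReal.ofReal_pow (by positivity)]
  exact pow_le_pow_left₀ zero_le (tsum_exp_neg_mul_int_sq_le hβ) n

theorem one_le_sum_sq_of_ne_zero {n : ℕ} {z : Fin n → ℤ} (hz : z ≠ 0) :
    (1 : ℝ) ≤ ∑ i, (z i : ℝ) ^ 2 := by
  obtain ⟨i, hi⟩ := Function.ne_iff.mp hz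
  refine le_trans ?_ (Finset.single_le_sum (f := fun i => (z i : ℝ) ^ 2)
    (fun i _ => sq_nonneg _) (Finset.mem_univ i))
  have : (1 : ℤ) ≤ z i ^ 2 := by
    have : z i ^ 2 ≠ 0 := pow_ne_zero 2 hi
    have := sq_nonneg (z i)
    omega
  exact_mod_cast this

theorem mulVec_transpose_inv {n : ℕ} {A : Matrix (Fin n) (Fin n) ℝ} (hA : A.det ≠ 0)
    (y : Fin n → ℝ) : Aᵀ *ᵥ ((A⁻¹)ᵀ *ᵥ y) = y := by
  have hdet : IsUnit (Aᵀ).det := by rwa [Matrix.det_transpose, isUnit_iff_ne_zero]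
  rw [Matrix.mulVec_mulVec, Matrix.transpose_nonsing_inv, Matrix.mul_nonsing_inv _ hdet,
    Matrix.one_mulVec]

/-- The parameters whose infimum is the smoothing parameter. -/
def smoothingSet {n : ℕ} (ε : ℝ) (A : Matrix (Fin n) (Fin n) ℝ) : Set ℝ :=
  {s | 0 < s ∧ dualGaussSum A s ≤ ENNReal.ofReal ε}

namespace IsLLLReduced

variable {n : ℕ} {R : Matrix (Fin n) (Fin n) ℝ} (hR : IsLLLReduced R) (hdet : R.det ≠ 0)
include hR hdet

theorem sum_sq_le {η : ℝ} (hη : ∀ i, |R i i| ≤ 8 ^ n * η) (y : Fin n → ℝ) :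
    ∑ i, y i ^ 2 ≤ 512 ^ n * (η ^ 2 * euclNorm ((R⁻¹)ᵀ *ᵥ y) ^ 2) := by
  have := hR.sum_sq_mulVec_le hη ((R⁻¹)ᵀ *ᵥ y)
  rwa [mulVec_transpose_inv hdet] at this

/-- The single dual vector `R⁻ᵀ eᵢ` must already have small Gaussian weight, which forces the
parameter to be large compared with `R i i`. -/
theorem abs_diag_le_of_mem_smoothingSet {ε s : ℝ} (hε : ε ≤ Real.exp (-Real.pi))
    (hs : s ∈ smoothingSet ε R) (i : Fin n) : |R i i| ≤ 8 ^ n * s := by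
  obtain ⟨hs0, hsum⟩ := hs
  set w := (R⁻¹)ᵀ *ᵥ fun j => ((Pi.single i 1 : Fin n → ℤ) j : ℝ) with hw
  have h1 : ENNReal.ofReal (rho (1 / s) 0 w) ≤ ENNReal.ofReal (Real.exp (-Real.pi)) := by
    refine le_trans ?_ (hsum.trans (ENNReal.ofReal_le_ofReal hε))
    refine le_trans (le_of_eq ?_) (ENNReal.le_tsum (Pi.single i 1 : Fin n → ℤ))
    rw [if_neg]
    intro h
    have := congrFun h i
    simp at this
  rw [ENNReal.ofReal_le_ofReal_iff (Real.exp_pos _).le, rho_one_div, Real.exp_le_exp] at h1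
  have h2 : 1 ≤ s * euclNorm w := by
    have h3 : 1 ≤ (s * euclNorm w) ^ 2 := by
      rw [mul_pow]
      have := Real.pi_pos
      nlinarith
    exact (one_le_sq_iff₀ (mul_nonneg hs0.le (euclNorm_nonneg w))).mp h3
  have hRw : Rᵀ *ᵥ w = fun j => ((Pi.single i 1 : Fin n → ℤ) j : ℝ) := mulVec_transpose_inv hdet _
  have h4 : euclNorm w * |R i i| ≤ 8 ^ n * 1 := by
    refine hR.euclNorm_mul_diag_le hdet (fun j => ?_) fun k hk => ?_
    · rw [hRw]
      by_cases hj : j = i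
      · subst hj; simp
      · simp [hj]
    · rw [hRw]
      simp [hk.ne]
  calc |R i i| ≤ (s * euclNorm w) * |R i i| := le_mul_of_one_le_left (abs_nonneg _) h2
    _ = s * (euclNorm w * |R i i|) := by ring
    _ ≤ s * (8 ^ n * 1) := by gcongr
    _ = _ := by ring

theorem smoothingSet_nonempty {ε : ℝ} (hε : 0 < ε) : (smoothingSet ε R).Nonempty := by
  set σ := 1 + ∑ i, |R i i| with hσ
  have hσ0 : 0 < σ := by
    have : 0 ≤ ∑ i, |R i i| := Finset.sum_nonneg fun i _ => abs_nonneg _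
    linarith
  have hdiag : ∀ i, |R i i| ≤ 8 ^ n * σ := fun i => by
    have h1 := Finset.single_le_sum (f := fun i => |R i i|) (fun i _ => abs_nonneg _)
      (Finset.mem_univ i)
    have h2 : (1 : ℝ) ≤ 8 ^ n := one_le_pow₀ (by norm_num)
    nlinarith
  set β := Real.pi / (512 ^ n * σ ^ 2) with hβ
  have hβ0 : 0 < β := by have := Real.pi_pos; positivity
  set G := (2 + 2 / β) ^ n with hG
  have hG0 : 0 < G := by positivity
  -- All nonzero terms decay at least like `exp (-β (s² - 1))`, uniformly.
  obtain ⟨s, hs1, hs⟩ : ∃ s : ℝ, 1 ≤ s ∧ Real.exp (-β * (s ^ 2 - 1)) * G ≤ ε := by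
    refine ⟨1 + |Real.log (G / ε)| / β,
      by linarith [div_nonneg (abs_nonneg (Real.log (G / ε))) hβ0.le], ?_⟩
    set l := |Real.log (G / ε)| with hl
    have hl0 : 0 ≤ l := abs_nonneg _
    have h1 : Real.exp (-β * ((1 + l / β) ^ 2 - 1)) ≤ Real.exp (-l) := by
      refine Real.exp_le_exp.mpr ?_
      have : -β * ((1 + l / β) ^ 2 - 1) = -(2 * l) - l ^ 2 / β := by field_simp; ring
      rw [this]
      have : 0 ≤ l ^ 2 / β := by positivity
      linarith
    have h2 : Real.exp (-l) ≤ ε / G := by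
      rw [← Real.exp_log (div_pos hε hG0)]
      refine Real.exp_le_exp.mpr ?_
      have : Real.log (ε / G) = -Real.log (G / ε) := by rw [← Real.log_inv, inv_div]
      rw [this]
      exact neg_le_neg (le_abs_self _)
    calc _ ≤ ε / G * G := by gcongr; exact h1.trans h2
      _ = ε := by field_simp
  refine ⟨s, by linarith, ?_⟩
  calc dualGaussSum R s ≤ ∑' z : Fin n → ℤ, ENNReal.ofReal (Real.exp (-β * (s ^ 2 - 1))) *
        ENNReal.ofReal (Real.exp (-β * ∑ i, (z i : ℝ) ^ 2)) := by
        refine ENNReal.tsum_le_tsum fun z => ?_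
        split_ifs with hz
        · exact zero_le
        rw [← ENNReal.ofReal_mul (Real.exp_pos _).le, ← Real.exp_add, rho_one_div]
        refine ENNReal.ofReal_le_ofReal (Real.exp_le_exp.mpr ?_)
        have h1 := hR.sum_sq_le hdet hdiag fun i => (z i : ℝ)
        set q := euclNorm ((R⁻¹)ᵀ *ᵥ fun i => (z i : ℝ)) ^ 2
        set S := ∑ i, (z i : ℝ) ^ 2
        have hS : 1 ≤ S := one_le_sum_sq_of_ne_zero hz
        have h2 : β * S ≤ Real.pi * q := by
          rw [hβ, div_mul_eq_mul_div, div_le_iff₀ (by positivity)]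
          nlinarith [Real.pi_pos]
        have h3 : 0 ≤ s ^ 2 - 1 := by nlinarith
        have h4 : β * S * s ^ 2 ≤ Real.pi * q * s ^ 2 := by gcongr
        have h5 : β * (s ^ 2 - 1) ≤ β * (s ^ 2 - 1) * S :=
          le_mul_of_one_le_right (by positivity) hS
        nlinarith
    _ ≤ ENNReal.ofReal (Real.exp (-β * (s ^ 2 - 1))) * ENNReal.ofReal G := by
        rw [ENNReal.tsum_mul_left]
        gcongr
        exact tsum_exp_neg_mul_sum_sq_le hβ0
    _ ≤ ENNReal.ofReal ε := by
        rw [← ENNReal.ofReal_mul (Real.exp_pos _).le]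
        exact ENNReal.ofReal_le_ofReal hs

/-- The infimum in the definition of the smoothing parameter is attained. -/
theorem dualGaussSum_sInf_le {ε : ℝ} (hε : 0 < ε) :
    dualGaussSum R (sInf (smoothingSet ε R)) ≤ ENNReal.ofReal ε := by
  have hne := hR.smoothingSet_nonempty hdet hε
  have hbdd : BddBelow (smoothingSet ε R) := ⟨0, fun s hs => hs.1.le⟩
  have hclosed : IsClosed {s : ℝ | dualGaussSum R s ≤ ENNReal.ofReal ε} := by
    have : {s : ℝ | dualGaussSum R s ≤ ENNReal.ofReal ε} = ⋂ F : Finset (Fin n → ℤ),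
        {s : ℝ | ∑ z ∈ F, (if z = 0 then 0 else
          ENNReal.ofReal (rho (1 / s) 0 ((R⁻¹)ᵀ *ᵥ fun i => (z i : ℝ)))) ≤ ENNReal.ofReal ε} := by
      ext s
      simp only [dualGaussSum, Set.mem_ofPred_eq, Set.mem_iInter, ENNReal.tsum_eq_iSup_sum,
        iSup_le_iff]
    rw [this]
    refine isClosed_iInter fun F => isClosed_le ?_ continuous_const
    refine continuous_finsetSum _ fun z _ => ?_
    split_ifs
    · exact continuous_const
    · simp only [rho_one_div]
      exact ENNReal.continuous_ofReal.comp (by fun_prop)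
  exact closure_minimal (fun s hs => hs.2) hclosed (csInf_mem_closure hne hbdd)

theorem abs_diag_le_sInf {ε : ℝ} (hε : 0 < ε) (hε1 : ε ≤ Real.exp (-Real.pi)) (i : Fin n) :
    |R i i| ≤ 8 ^ n * sInf (smoothingSet ε R) := by
  have h : |R i i| / 8 ^ n ≤ sInf (smoothingSet ε R) := by
    refine le_csInf (hR.smoothingSet_nonempty hdet hε) fun s hs => ?_
    rw [div_le_iff₀' (by positivity)]
    exact hR.abs_diag_le_of_mem_smoothingSet hdet hε1 hs i
  rwa [div_le_iff₀' (by positivity)] at h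

end IsLLLReduced

theorem smoothingParameter_eq_sInf {n : ℕ} (ε : ℝ) {A : Matrix (Fin n) (Fin n) ℝ}
    (hA : A.det ≠ 0) : smoothingParameter ε A = sInf (smoothingSet ε A) := by
  simp only [smoothingParameter, smoothingSet, tsum_dualLattice_eq hA]

/-! ### Perturbation of the basis -/

/-- The first term covers `q ≤ 1 / (4 π τ)`, the second one larger `q`. -/
theorem exp_perturbed_le {q τ : ℝ} (hq : 0 ≤ q) (hτ : 0 < τ) (hτ1 : τ ≤ 1 / 4) :
    Real.exp (-Real.pi * ((1 - 2 * τ) * q)) ≤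
      2 * Real.exp (-Real.pi * q) + Real.exp (-(1 / (16 * τ))) * Real.exp (-(Real.pi / 4) * q) := by
  have hpi := Real.pi_pos
  by_cases h : 4 * Real.pi * τ * q ≤ 1
  · have h1 : Real.exp (-Real.pi * ((1 - 2 * τ) * q)) =
        Real.exp (2 * Real.pi * τ * q) * Real.exp (-Real.pi * q) := by
      rw [← Real.exp_add]; congr 1; ring
    have h2 : Real.exp (2 * Real.pi * τ * q) ≤ 2 := by
      have h3 : Real.exp (2 * Real.pi * τ * q) ^ 2 ≤ 2 ^ 2 := by
        rw [← Real.exp_nat_mul]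
        refine (Real.exp_le_exp.mpr (show _ ≤ (1 : ℝ) by push_cast; linarith)).trans ?_
        linarith [Real.exp_one_lt_d9]
      exact le_of_sq_le_sq h3 (by norm_num)
    rw [h1]
    have h4 := mul_le_mul_of_nonneg_right h2 (Real.exp_pos (-Real.pi * q)).le
    have h5 := mul_pos (Real.exp_pos (-(1 / (16 * τ)))) (Real.exp_pos (-(Real.pi / 4) * q))
    linarith
  · have h1 : Real.exp (-Real.pi * ((1 - 2 * τ) * q)) ≤
        Real.exp (-(1 / (16 * τ))) * Real.exp (-(Real.pi / 4) * q) := by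
      rw [← Real.exp_add]
      refine Real.exp_le_exp.mpr ?_
      have h2 : 1 / (16 * τ) ≤ Real.pi / 4 * q := by
        rw [div_le_iff₀ (by positivity)]
        nlinarith
      have h3 : τ * (Real.pi * q) ≤ 1 / 4 * (Real.pi * q) := by gcongr
      nlinarith
    linarith [Real.exp_pos (-Real.pi * q)]

/-- A small perturbation of the basis hardly changes the Gaussian mass of the dual lattice. -/
theorem IsLLLReduced.dualGaussSum_perturbed_le {n : ℕ} {R P : Matrix (Fin n) (Fin n) ℝ}
    (hR : IsLLLReduced R) (hdet : R.det ≠ 0) (hP : P.det ≠ 0) {η ε T τ : ℝ} (hη : 0 < η)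
    (hε : 0 ≤ ε) (hdiag : ∀ i, |R i i| ≤ 8 ^ n * η)
    (hsum : dualGaussSum R η ≤ ENNReal.ofReal ε) (hT : 0 < T) (hτ : 0 < τ) (hτ1 : τ ≤ 1 / 4)
    (hclose : ∀ w w' : Fin n → ℝ, Rᵀ *ᵥ w = Pᵀ *ᵥ w' →
      euclNorm (w - T • w') ≤ τ * (T * euclNorm w')) :
    dualGaussSum P (T * η) ≤
      ENNReal.ofReal (2 * ε + Real.exp (-(1 / (16 * τ))) * Real.exp (8 * 4 ^ n)) := by
  have hpi := Real.pi_pos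
  set β := Real.pi / 4 / 512 ^ n with hβ
  have hβ0 : 0 < β := by positivity
  have hterm : ∀ z : Fin n → ℤ, (if z = 0 then 0 else
      ENNReal.ofReal (rho (1 / (T * η)) 0 ((P⁻¹)ᵀ *ᵥ fun i => (z i : ℝ)))) ≤
      ENNReal.ofReal 2 * (if z = 0 then 0 else
        ENNReal.ofReal (rho (1 / η) 0 ((R⁻¹)ᵀ *ᵥ fun i => (z i : ℝ)))) +
      ENNReal.ofReal (Real.exp (-(1 / (16 * τ)))) *
        ENNReal.ofReal (Real.exp (-β * ∑ i, (z i : ℝ) ^ 2)) := fun z => by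
    split_ifs with hz
    · exact zero_le
    rw [rho_one_div, rho_one_div, ← ENNReal.ofReal_mul zero_le_two,
      ← ENNReal.ofReal_mul (Real.exp_pos _).le,
      ← ENNReal.ofReal_add (by positivity) (by positivity)]
    refine ENNReal.ofReal_le_ofReal ?_
    have hS := hR.sum_sq_le hdet hdiag fun i => (z i : ℝ)
    have hc := hclose ((R⁻¹)ᵀ *ᵥ fun i => (z i : ℝ)) ((P⁻¹)ᵀ *ᵥ fun i => (z i : ℝ))
      (by rw [mulVec_transpose_inv hdet, mulVec_transpose_inv hP])
    set w := (R⁻¹)ᵀ *ᵥ fun i => (z i : ℝ)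
    set w' := (P⁻¹)ᵀ *ᵥ fun i => (z i : ℝ)
    set q := η ^ 2 * euclNorm w ^ 2 with hq
    have hq0 : 0 ≤ q := by positivity
    have h1 : euclNorm w ≤ (1 + τ) * (T * euclNorm w') := by
      have h2 := euclNorm_add_le (w - T • w') (T • w')
      rw [sub_add_cancel, euclNorm_smul, abs_of_pos hT] at h2
      linarith
    have h3 : (1 - 2 * τ) * q ≤ (T * η) ^ 2 * euclNorm w' ^ 2 := by
      have h4 : euclNorm w ^ 2 ≤ ((1 + τ) * (T * euclNorm w')) ^ 2 :=
        pow_le_pow_left₀ (euclNorm_nonneg w) h1 2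
      have h5 : (1 - 2 * τ) * (1 + τ) ^ 2 ≤ 1 := by nlinarith [sq_nonneg τ]
      have h6 : 0 ≤ 1 - 2 * τ := by linarith
      calc (1 - 2 * τ) * q ≤ (1 - 2 * τ) * (η ^ 2 * ((1 + τ) * (T * euclNorm w')) ^ 2) := by
            rw [hq]; gcongr
        _ = ((1 - 2 * τ) * (1 + τ) ^ 2) * ((T * η) ^ 2 * euclNorm w' ^ 2) := by ring
        _ ≤ 1 * ((T * η) ^ 2 * euclNorm w' ^ 2) := by gcongr
        _ = _ := one_mul _
    have h7 : Real.exp (-Real.pi * (T * η) ^ 2 * euclNorm w' ^ 2) ≤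
        Real.exp (-Real.pi * ((1 - 2 * τ) * q)) := Real.exp_le_exp.mpr (by nlinarith)
    have h8 : Real.exp (-(Real.pi / 4) * q) ≤ Real.exp (-β * ∑ i, (z i : ℝ) ^ 2) := by
      refine Real.exp_le_exp.mpr ?_
      have : β * ∑ i, (z i : ℝ) ^ 2 ≤ Real.pi / 4 * q := by
        rw [hβ, div_mul_eq_mul_div, div_le_iff₀ (by positivity)]
        nlinarith
      linarith
    refine h7.trans ((exp_perturbed_le hq0 hτ hτ1).trans ?_)
    rw [hq, mul_assoc (-Real.pi)]
    gcongr
  have hpow : (2 + 2 / β) ^ n ≤ Real.exp (8 * 4 ^ n) := by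
    rcases Nat.eq_zero_or_pos n with rfl | hn
    · simp
    have h1 : 2 + 2 / β ≤ 4 * 512 ^ n := by
      have h2 : 2 / β ≤ 8 / 3 * 512 ^ n := by
        rw [hβ, div_div_eq_mul_div, div_le_iff₀ (by positivity)]
        have := Real.pi_gt_three
        have h5 : (0 : ℝ) < 512 ^ n := by positivity
        nlinarith
      have h3 : (512 : ℝ) ≤ 512 ^ n := le_self_pow₀ (by norm_num) hn.ne'
      linarith
    have h4 : (2048 : ℝ) ≤ Real.exp 8 := by
      have h5 : (2.7 : ℝ) ^ 8 ≤ Real.exp 1 ^ 8 :=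
        pow_le_pow_left₀ (by norm_num) (by linarith [Real.exp_one_gt_d9]) 8
      rw [← Real.exp_nat_mul] at h5
      norm_num at h5
      linarith
    have h6 : (n : ℝ) * n ≤ 4 ^ n := by
      have : (4 : ℝ) ^ n = 2 ^ n * 2 ^ n := by rw [← mul_pow]; norm_num
      rw [this]
      have := natCast_le_two_pow n
      gcongr
    calc (2 + 2 / β) ^ n ≤ (4 ^ n * 512 ^ n) ^ n := by
          refine pow_le_pow_left₀ (by positivity) (h1.trans ?_) n
          gcongr
          exact le_self_pow₀ (by norm_num) hn.ne'
      _ = (2048 ^ n) ^ n := by rw [← mul_pow]; norm_num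
      _ ≤ (Real.exp 8 ^ n) ^ n := by gcongr
      _ = Real.exp (8 * (n * n)) := by
          rw [← Real.exp_nat_mul, ← Real.exp_nat_mul]; congr 1; ring
      _ ≤ _ := Real.exp_le_exp.mpr (by linarith)
  calc dualGaussSum P (T * η) ≤ _ := ENNReal.tsum_le_tsum hterm
    _ ≤ ENNReal.ofReal 2 * ENNReal.ofReal ε +
        ENNReal.ofReal (Real.exp (-(1 / (16 * τ)))) * ENNReal.ofReal (Real.exp (8 * 4 ^ n)) := by
        rw [ENNReal.tsum_add, ENNReal.tsum_mul_left, ENNReal.tsum_mul_left]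
        gcongr
        · exact hsum
        · exact (tsum_exp_neg_mul_sum_sq_le hβ0).trans (ENNReal.ofReal_le_ofReal hpow)
    _ = _ := by
        rw [← ENNReal.ofReal_mul (by norm_num), ← ENNReal.ofReal_mul (Real.exp_pos _).le,
          ← ENNReal.ofReal_add (by positivity) (by positivity)]

/-! ### The first minimum -/

theorem one_le_euclNorm_intCast {n : ℕ} {z : Fin n → ℤ} (hz : z ≠ 0) :
    1 ≤ euclNorm fun i => (z i : ℝ) := by
  rw [← one_le_sq_iff₀ (euclNorm_nonneg _), euclNorm_sq]
  exact one_le_sum_sq_of_ne_zero hz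

/-- A nonzero lattice vector of length at most `r` witnesses `λ₁ ≤ r`. -/
theorem one_le_finrank_span_of_mem {n : ℕ} {L : Set (Fin n → ℝ)} {r : ℝ} {x : Fin n → ℝ}
    (hx : x ∈ L) (hx0 : x ≠ 0) (hr : euclNorm x ≤ r) :
    1 ≤ Module.finrank ℝ (Submodule.span ℝ (L ∩ {x | euclNorm x ≤ r})) := by
  rw [Submodule.one_le_finrank_iff, Submodule.ne_bot_iff]
  exact ⟨x, Submodule.subset_span ⟨hx, hr⟩, hx0⟩

theorem successiveMinimum_one_le {n : ℕ} {L : Set (Fin n → ℝ)} {x : Fin n → ℝ}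
    (hx : x ∈ L) (hx0 : x ≠ 0) : successiveMinimum L 1 ≤ euclNorm x := by
  refine csInf_le ⟨0, fun r hr => ?_⟩ (one_le_finrank_span_of_mem hx hx0 le_rfl)
  by_contra hneg
  have hempty : L ∩ {x | euclNorm x ≤ r} = ∅ := by
    ext y
    simp only [Set.mem_inter_iff, Set.mem_ofPred_eq, Set.mem_empty_iff_false, iff_false, not_and]
    intro _ hy
    exact hneg ((euclNorm_nonneg y).trans hy)
  rw [Set.mem_ofPred_eq, hempty, Submodule.span_empty, finrank_bot] at hr
  omega

theorem one_le_successiveMinimum {n : ℕ} (B : Matrix (Fin n) (Fin n) ℤ) {x : Fin n → ℝ}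
    (hx : x ∈ lattice (toReal B)) (hx0 : x ≠ 0) :
    1 ≤ successiveMinimum (lattice (toReal B)) 1 := by
  refine le_csInf ⟨euclNorm x, one_le_finrank_span_of_mem hx hx0 le_rfl⟩ fun r hr => ?_
  rw [Set.mem_ofPred_eq, Submodule.one_le_finrank_iff, Ne, Submodule.span_eq_bot] at hr
  push Not at hr
  obtain ⟨y, ⟨⟨z, rfl⟩, hyr⟩, hy0⟩ := hr
  refine le_trans ?_ hyr
  have h1 : (toReal B *ᵥ fun i => (z i : ℝ)) = fun i => ((B *ᵥ z) i : ℝ) :=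
    funext fun i => toReal_mulVec_intCast B z i
  rw [h1] at hy0 ⊢
  refine one_le_euclNorm_intCast fun h => hy0 ?_
  rw [h]
  funext i
  simp

/-- The first basis vector of the LLL-reduced basis is a lattice vector of length `|R₀₀|`. -/
theorem IsLLLReduced.exists_mem_lattice {n : ℕ} [NeZero n] {B U : Matrix (Fin n) (Fin n) ℤ}
    {Q R : Matrix (Fin n) (Fin n) ℝ} (hQ : Q ∈ Matrix.orthogonalGroup (Fin n) ℝ)
    (hBU : toReal (B * U) = Q * R) (hR : IsLLLReduced R) (hdet : R.det ≠ 0) :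
    ∃ x ∈ lattice (toReal B), x ≠ 0 ∧ euclNorm x = |R 0 0| := by
  have hcol : R *ᵥ Pi.single 0 1 = Pi.single 0 (R 0 0) := by
    rw [Matrix.mulVec_single_one]
    funext i
    by_cases hi : i = 0
    · subst hi; simp
    · rw [Matrix.col_apply, hR.upper i 0 (Fin.pos_iff_ne_zero.mpr hi)]
      simp [hi]
  have hnorm : euclNorm (toReal (B * U) *ᵥ Pi.single 0 1) = |R 0 0| := by
    rw [hBU, ← Matrix.mulVec_mulVec, euclNorm_mulVec_orthogonal hQ, hcol, euclNorm,
      Finset.sum_eq_single 0]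
    · simp [Real.sqrt_sq_eq_abs]
    · intro i _ hi
      simp [hi]
    · simp
  refine ⟨_, ⟨U *ᵥ Pi.single 0 1, ?_⟩, ?_, hnorm⟩
  · have h1 : (fun i => ((U *ᵥ Pi.single 0 1) i : ℝ)) = toReal U *ᵥ Pi.single 0 1 := by
      have h2 : (Pi.single 0 1 : Fin n → ℝ) = fun i => ((Pi.single 0 1 : Fin n → ℤ) i : ℝ) := by
        funext i
        by_cases hi : i = 0
        · subst hi; simp
        · simp [hi]
      rw [h2]
      exact (funext fun i => toReal_mulVec_intCast U _ i).symm
    rw [h1, Matrix.mulVec_mulVec, toReal_mul]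
  · intro h
    rw [h] at hnorm
    have : euclNorm (0 : Fin n → ℝ) = 0 := by simp [euclNorm]
    rw [this] at hnorm
    exact hR.diag_ne_zero hdet 0 (abs_eq_zero.mp hnorm.symm)

/-! ### The rounded basis -/

theorem abs_perturbedBasis_sub_le {n : ℕ} {R : Matrix (Fin n) (Fin n) ℝ} (hR : IsLLLReduced R)
    (T : ℕ) {d : ℤ} {D : ℝ} (hd : |(d : ℝ)| ≤ D) (i j : Fin n) :
    |toReal (perturbedBasis R T d) i j - T * R i j| ≤ 1 + D := by
  have hD : 0 ≤ D := (abs_nonneg _).trans hd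
  simp only [toReal, Matrix.map_apply, perturbedBasis, Matrix.of_apply]
  by_cases hij : i ≤ j
  · rw [if_pos hij]
    have h1 : |((round ((T : ℝ) * R i j) : ℤ) : ℝ) - T * R i j| ≤ 1 / 2 := by
      rw [abs_sub_comm]; exact abs_sub_round _
    have h2 : |((if (i : ℕ) = 0 ∧ (j : ℕ) + 1 = n then d else 0 : ℤ) : ℝ)| ≤ D := by
      split_ifs
      · exact hd
      · simpa using hD
    push_cast at h2 ⊢
    rw [add_sub_right_comm]
    exact (abs_add_le _ _).trans (by linarith)
  · rw [if_neg hij, hR.upper i j (not_le.mp hij), mul_zero, sub_zero]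
    split_ifs
    · simpa using hD
    · simpa using by linarith

/-- Dual vectors of `R` and of a perturbation `P` of `T R` with the same coordinates. -/
theorem IsLLLReduced.euclNorm_sub_smul_mul_le {n : ℕ} [NeZero n]
    {R P : Matrix (Fin n) (Fin n) ℝ} (hR : IsLLLReduced R) (hdet : R.det ≠ 0) {T D : ℝ}
    (hP : ∀ i j, |P i j - T * R i j| ≤ D) {w w' : Fin n → ℝ} (h : Rᵀ *ᵥ w = Pᵀ *ᵥ w') :
    euclNorm (w - T • w') * |R 0 0| ≤ 16 ^ n * D * euclNorm w' := by
  have hD : 0 ≤ D := (abs_nonneg _).trans (hP 0 0)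
  have hw := euclNorm_nonneg w'
  have h1 : ∀ j, (Rᵀ *ᵥ (w - T • w')) j = ∑ i, (P i j - T * R i j) * w' i := fun j => by
    rw [Matrix.mulVec_sub, Matrix.mulVec_smul, h]
    simp only [Pi.sub_apply, Pi.smul_apply, Matrix.mulVec, dotProduct, Matrix.transpose_apply,
      smul_eq_mul, Finset.mul_sum, ← Finset.sum_sub_distrib]
    exact Finset.sum_congr rfl fun i _ => by ring
  have h2 : ∀ j, |(Rᵀ *ᵥ (w - T • w')) j| ≤ n * (D * euclNorm w') := fun j => by
    rw [h1]
    refine (Finset.abs_sum_le_sum_abs _ _).trans ?_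
    refine (Finset.sum_le_sum fun i _ => ?_).trans_eq (b := ∑ _i : Fin n, D * euclNorm w')
      (by simp)
    rw [abs_mul]
    exact mul_le_mul (hP i j) (abs_le_euclNorm w' i) (abs_nonneg _) hD
  refine (hR.euclNorm_mul_diag_le hdet (i := 0) h2 fun k hk => absurd hk (by simp)).trans ?_
  calc (8 : ℝ) ^ n * (n * (D * euclNorm w')) ≤ 8 ^ n * (2 ^ n * (D * euclNorm w')) := by
        gcongr; exact natCast_le_two_pow n
    _ = (8 * 2) ^ n * D * euclNorm w' := by rw [mul_pow]; ring
    _ = _ := by norm_num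

/-- The determinant of an integer matrix close to `T R` is not small: a short vector of the dual
lattice becomes a nonzero integer vector after multiplication by the determinant. -/
theorem IsLLLReduced.mul_diag_le_det {n : ℕ} [NeZero n] {R : Matrix (Fin n) (Fin n) ℝ}
    {P : Matrix (Fin n) (Fin n) ℤ} (hR : IsLLLReduced R) (hdet : R.det ≠ 0) (hP : P.det ≠ 0)
    {T : ℝ} (hT : 0 < T) (hclose : ∀ w w' : Fin n → ℝ, Rᵀ *ᵥ w = (toReal P)ᵀ *ᵥ w' →
      euclNorm (w - T • w') ≤ 1 / 2 * (T * euclNorm w')) :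
    T * |R 0 0| ≤ 2 * 8 ^ n * |(P.det : ℝ)| := by
  have hP' : (toReal P).det ≠ 0 := by rw [det_toReal]; exact_mod_cast hP
  set e : Fin n → ℤ := Pi.single 0 1 with he
  set w := (R⁻¹)ᵀ *ᵥ fun i => (e i : ℝ) with hw
  set w' := ((toReal P)⁻¹)ᵀ *ᵥ fun i => (e i : ℝ) with hw'
  have hRw : Rᵀ *ᵥ w = fun i => (e i : ℝ) := mulVec_transpose_inv hdet _
  have hPw : (toReal P)ᵀ *ᵥ w' = fun i => (e i : ℝ) := mulVec_transpose_inv hP' _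
  have h1 := hclose w w' (hRw.trans hPw.symm)
  have h2 : T * euclNorm w' ≤ 2 * euclNorm w := by
    have h3 := euclNorm_add_le w ((-1 : ℝ) • (w - T • w'))
    have h4 : w + (-1 : ℝ) • (w - T • w') = T • w' := by
      simp
    rw [h4, euclNorm_smul, euclNorm_smul, abs_of_pos hT] at h3
    norm_num at h3
    linarith
  have h5 : euclNorm w * |R 0 0| ≤ 8 ^ n * 1 := by
    refine hR.euclNorm_mul_diag_le hdet (fun j => ?_) fun k hk => absurd hk (by simp)
    rw [hRw]
    by_cases hj : j = 0
    · subst hj; simp [he]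
    · simp [he, hj]
  have h6 : 1 ≤ |(P.det : ℝ)| * euclNorm w' := by
    have h7 : (fun i => ((Pᵀ.adjugate *ᵥ e) i : ℝ)) = (P.det : ℝ) • w' := by
      have h8 : (P.det : ℝ) • w' = ((toReal P)ᵀ).adjugate *ᵥ ((toReal P)ᵀ *ᵥ w') := by
        rw [Matrix.mulVec_mulVec, Matrix.adjugate_mul, Matrix.det_transpose, det_toReal,
          Matrix.smul_mulVec, Matrix.one_mulVec]
      have h9 : ((toReal P)ᵀ).adjugate = toReal (Pᵀ.adjugate) :=
        ((Int.castRingHom ℝ).map_adjugate Pᵀ).symm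
      rw [h8, hPw, h9]
      exact (funext fun i => toReal_mulVec_intCast _ e i).symm
    rw [← euclNorm_smul, ← h7]
    refine one_le_euclNorm_intCast fun h0 => ?_
    have h10 : (P.det : ℝ) • w' = 0 := by rw [← h7, h0]; funext i; simp
    have h11 : w' = 0 := (smul_eq_zero.mp h10).resolve_left (by exact_mod_cast hP)
    rw [h11, Matrix.mulVec_zero] at hPw
    have := congrFun hPw 0
    simp [he] at this
  calc T * |R 0 0| ≤ (|(P.det : ℝ)| * euclNorm w') * (T * |R 0 0|) :=
        le_mul_of_one_le_left (by positivity) h6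
    _ = |(P.det : ℝ)| * (T * euclNorm w') * |R 0 0| := by ring
    _ ≤ |(P.det : ℝ)| * (2 * euclNorm w) * |R 0 0| := by gcongr
    _ = 2 * |(P.det : ℝ)| * (euclNorm w * |R 0 0|) := by ring
    _ ≤ 2 * |(P.det : ℝ)| * (8 ^ n * 1) := by gcongr
    _ = _ := by ring

theorem IsLLLReduced.abs_entry_le {n : ℕ} [NeZero n] {R : Matrix (Fin n) (Fin n) ℝ}
    (hR : IsLLLReduced R) (h1 : 1 ≤ |R 0 0|) (i j : Fin n) :
    |R i j| ≤ (2 ^ n) ^ n * |R.det| := by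
  have hdiag : ∀ i, |R i i| ≤ (2 ^ n) ^ n * |R.det| := fun i => by
    have h2 : ∀ k, 1 ≤ 2 ^ n * |R k k| := fun k => h1.trans (hR.abs_diag_le_pow (Fin.zero_le k))
    have h3 : 1 ≤ ∏ k ∈ Finset.univ.erase i, 2 ^ n * |R k k| :=
      Finset.one_le_prod fun k _ => h2 k
    rw [hR.det_eq, Finset.abs_prod]
    calc |R i i| ≤ 2 ^ n * |R i i| :=
          le_mul_of_one_le_left (abs_nonneg _) (one_le_pow₀ (by norm_num))
      _ ≤ 2 ^ n * |R i i| * ∏ k ∈ Finset.univ.erase i, 2 ^ n * |R k k| :=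
          le_mul_of_one_le_right (by positivity) h3
      _ = ∏ k, 2 ^ n * |R k k| :=
          Finset.mul_prod_erase Finset.univ (fun k => 2 ^ n * |R k k|) (Finset.mem_univ i)
      _ = _ := by
          rw [Finset.prod_mul_distrib, Finset.prod_const, Finset.card_univ, Fintype.card_fin]
  rcases lt_trichotomy i j with h | h | h
  · have := hR.size_reduced i j h
    linarith [hdiag i, abs_nonneg (R i i)]
  · rw [← h]; exact hdiag i
  · rw [hR.upper i j h, abs_zero]; positivity

/-- An upper bound for the determinant of the rounded basis. The bound `D = K log N` on the shift
of the corner entry depends on the determinant `N` itself, but only logarithmically. -/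
theorem log_det_le {n N : ℕ} [NeZero n] {R : Matrix (Fin n) (Fin n) ℝ}
    {P : Matrix (Fin n) (Fin n) ℤ} (hR : IsLLLReduced R) (h1 : 1 ≤ |R 0 0|) {K T X : ℝ}
    (hK : 0 < K) (hT : 1 ≤ T) (hdet : |R.det| ≤ T)
    (hP : ∀ i j, |toReal P i j - T * R i j| ≤ 1 + K * Real.log N)
    (hN : |(P.det : ℝ)| = N) (hN0 : 0 < N) (hTX : T ≤ X) (hX : 1 ≤ Real.log X) :
    Real.log N ≤ (8 + 2 / K + 4 * K) * 8 ^ n * Real.log X := by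
  have hn : (1 : ℝ) ≤ n := by exact_mod_cast NeZero.one_le
  have hL : 0 ≤ Real.log N := Real.log_natCast_nonneg N
  set L := Real.log N with hLdef
  set y := 2 + K * L with hy
  have hy0 : 0 < y := by positivity
  have hentry : ∀ i j, |toReal P i j| ≤ T ^ 2 * (2 ^ n) ^ n * y := fun i j => by
    have h2 : |toReal P i j| ≤ |toReal P i j - T * R i j| + |T * R i j| := by
      simpa using abs_add_le (toReal P i j - T * R i j) (T * R i j)
    have h3 : |T * R i j| ≤ T * ((2 ^ n) ^ n * T) := by
      rw [abs_mul, abs_of_pos (by linarith : 0 < T)]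
      gcongr
      exact (hR.abs_entry_le h1 i j).trans (by gcongr)
    have h4 : 1 ≤ T ^ 2 * (2 ^ n) ^ n := by
      have : (1 : ℝ) ≤ (2 ^ n) ^ n := one_le_pow₀ (one_le_pow₀ (by norm_num))
      have h5 : 1 ≤ T ^ 2 := one_le_pow₀ hT
      nlinarith
    have h5 : 0 ≤ K * L := by positivity
    have h6 := hP i j
    rw [hy]
    nlinarith
  have hdetP : (N : ℝ) ≤ (2 ^ n * (T ^ 2 * (2 ^ n) ^ n * y)) ^ n := by
    have h2 := Matrix.det_le (A := toReal P) (abv := AbsoluteValue.abs) hentry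
    rw [Fintype.card_fin, AbsoluteValue.abs_apply, det_toReal, hN, nsmul_eq_mul] at h2
    refine h2.trans ?_
    rw [mul_pow ((2 : ℝ) ^ n) (T ^ 2 * (2 ^ n) ^ n * y) n]
    gcongr
    calc ((n.factorial : ℕ) : ℝ) ≤ (n : ℝ) ^ n := by exact_mod_cast Nat.factorial_le_pow n
      _ ≤ (2 ^ n) ^ n := by gcongr; exact natCast_le_two_pow n
  have hlog : L ≤ n * (n * Real.log 2 + (2 * Real.log T + n * (n * Real.log 2) + Real.log y)) := by
    have hT0 : T ≠ 0 := by linarith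
    have h2 := Real.log_le_log (by exact_mod_cast hN0) hdetP
    rw [Real.log_pow, Real.log_mul (by positivity) (by positivity),
      Real.log_mul (by positivity) hy0.ne', Real.log_mul (by positivity) (by positivity),
      Real.log_pow, Real.log_pow, Real.log_pow, Real.log_pow] at h2
    exact_mod_cast h2
  -- The weight `2 n K` makes the contribution of `log N` to the right side equal to `log N / 2`.
  have hlogy : Real.log y ≤ y / (2 * n * K) + 2 * n * K := by
    have ha : 0 < 2 * n * K := by positivity
    have h2 : Real.log y = Real.log (y / (2 * n * K)) + Real.log (2 * n * K) := by
      rw [← Real.log_mul (by positivity) ha.ne']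
      congr 1; field_simp
    have h3 := Real.log_le_sub_one_of_pos (div_pos hy0 ha)
    have h4 := Real.log_le_sub_one_of_pos ha
    linarith
  have hlogy' : n * Real.log y ≤ 1 / K + L / 2 + 2 * n ^ 2 * K := by
    calc n * Real.log y ≤ n * (y / (2 * n * K) + 2 * n * K) := by gcongr
      _ = _ := by rw [hy]; field_simp
  have hlog2 : Real.log 2 ≤ 1 := by linarith [Real.log_two_lt_d9]
  have hlogT : Real.log T ≤ Real.log X := Real.log_le_log (by linarith) hTX
  set l := Real.log X with hl
  have hcube : (n : ℝ) ^ 3 ≤ 8 ^ n := by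
    calc (n : ℝ) ^ 3 ≤ (2 ^ n) ^ 3 := by gcongr; exact natCast_le_two_pow n
      _ = 8 ^ n := by rw [← pow_mul, mul_comm, pow_mul]; norm_num
  have hn2 : (n : ℝ) ^ 2 ≤ n ^ 3 := pow_le_pow_right₀ hn (by norm_num)
  have hn1 : (n : ℝ) ≤ n ^ 3 := le_self_pow₀ hn (by norm_num)
  have hn0 : (1 : ℝ) ≤ n ^ 3 := one_le_pow₀ hn
  have h2 : L ≤ 2 * (n ^ 2 + n ^ 3 + 2 * n * l + 1 / K + 2 * n ^ 2 * K) := by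
    have e1 : n * (n * Real.log 2) ≤ (n : ℝ) ^ 2 := by nlinarith
    have e2 : (n : ℝ) * (n * (n * Real.log 2)) ≤ n ^ 3 := by
      calc (n : ℝ) * (n * (n * Real.log 2)) ≤ n * n ^ 2 := by gcongr
        _ = _ := by ring
    have e3 : n * Real.log T ≤ n * l := by gcongr
    linarith
  refine h2.trans ?_
  have f1 : (n : ℝ) ^ 3 ≤ n ^ 3 * l := le_mul_of_one_le_right (by positivity) hX
  have f2 : n * l ≤ n ^ 3 * l := by gcongr
  have f3 : 1 / K ≤ 1 / K * (n ^ 3 * l) := le_mul_of_one_le_right (by positivity) (by nlinarith)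
  have f4 : (n : ℝ) ^ 2 * K ≤ n ^ 3 * l * K := by gcongr; linarith
  calc _ ≤ (8 + 2 / K + 4 * K) * (n ^ 3 * l) := by
        have : (8 + 2 / K + 4 * K) * (n ^ 3 * l) =
          8 * (n ^ 3 * l) + 2 * (1 / K * (n ^ 3 * l)) + 4 * (n ^ 3 * l * K) := by ring
        rw [this]
        linarith
    _ ≤ (8 + 2 / K + 4 * K) * (8 ^ n * l) := by gcongr
    _ = _ := by ring

/-! ### The choice of the constant -/

/-- For `C` large, `X = 2 ^ (C n)` beats every product of `2 ^ O(n)` with a power of `log X`. -/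
theorem exists_scale_constant {δ K A : ℝ} (hδ : 0 < δ) (hK : 0 < K) (hA : 0 < A) :
    ∃ C : ℝ, 0 < C ∧ ∀ (n : ℕ) (X : ℝ), 1 ≤ n → (2 : ℝ) ^ (C * n) ≤ X →
      1 ≤ Real.log X ∧ 2 * 8 ^ n * (2 : ℝ) ^ (24 * δ) < X ∧
      ∀ L : ℝ, 0 ≤ L → L ≤ A * 8 ^ n * Real.log X →
        16 * (16 ^ n * (1 + K * L) / X) * (8 * 4 ^ n + 5 * (1 + L / δ)) ≤ 1 := by
  set G := 16 * (1 + K * A) * (13 + 5 * (A / δ)) with hG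
  have hG0 : 0 < G := by positivity
  have hlog2 : (0.69 : ℝ) < Real.log 2 := by linarith [Real.log_two_gt_d9]
  refine ⟨64 * G + 24 * δ + 24, by positivity, fun n X hn hX => ?_⟩
  have hn' : (1 : ℝ) ≤ n := by exact_mod_cast hn
  have hX0 : 0 < X := lt_of_lt_of_le (by positivity) hX
  have hlogX : (64 * G + 24 * δ + 24) * n * Real.log 2 ≤ Real.log X := by
    rw [← Real.log_rpow (by norm_num)]
    exact Real.log_le_log (by positivity) hX
  have hl1 : 1 ≤ Real.log X := by
    have h1 : 24 * 1 * 0.69 ≤ (64 * G + 24 * δ + 24) * n * Real.log 2 := by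
      gcongr
      nlinarith
    linarith
  refine ⟨hl1, ?_, fun L hL0 hL => ?_⟩
  · refine lt_of_lt_of_le ?_ hX
    have h1 : (2 : ℝ) * 8 ^ n = 2 ^ (1 + 3 * (n : ℝ)) := by
      rw [Real.rpow_add (by norm_num), Real.rpow_one, Real.rpow_mul (by norm_num),
        Real.rpow_natCast]
      norm_num
    rw [h1, ← Real.rpow_add (by norm_num)]
    refine Real.rpow_lt_rpow_of_exponent_lt (by norm_num) ?_
    nlinarith [mul_pos hG0 (by linarith : (0 : ℝ) < n), mul_le_mul_of_nonneg_left hn' hδ.le]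
  · set l := Real.log X with hl
    set Y := Real.sqrt X with hY
    have hY0 : 0 < Y := Real.sqrt_pos.mpr hX0
    have hYX : X = Y * Y := (Real.mul_self_sqrt hX0.le).symm
    -- `log X = 4 log (X ^ (1/4)) ≤ 4 X ^ (1/4)`
    have hlY : l ^ 2 ≤ 16 * Y := by
      have h1 : l = 4 * Real.log (Real.sqrt Y) := by
        rw [Real.log_sqrt hY0.le, hl, hYX, Real.log_mul hY0.ne' hY0.ne']; ring
      have h2 := Real.log_le_sub_one_of_pos (Real.sqrt_pos.mpr hY0)
      have h3 : l ≤ 4 * Real.sqrt Y := by linarith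
      calc l ^ 2 ≤ (4 * Real.sqrt Y) ^ 2 := pow_le_pow_left₀ (by linarith) h3 2
        _ = 16 * Y := by rw [mul_pow, Real.sq_sqrt hY0.le]; norm_num
    have hYbig : 16 * G * 1024 ^ n ≤ Y := by
      have h1 : (2 : ℝ) ^ (32 * G + 10 * n) ≤ Y := by
        refine Real.le_sqrt_of_sq_le (le_trans ?_ hX)
        rw [← Real.rpow_natCast, ← Real.rpow_mul (by norm_num)]
        refine Real.rpow_le_rpow_of_exponent_le (by norm_num) ?_
        push_cast
        nlinarith [mul_le_mul_of_nonneg_left hn' hG0.le, mul_pos hδ (by linarith : (0 : ℝ) < n)]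
      have h2 : 16 * G ≤ (2 : ℝ) ^ (32 * G) := by
        rw [Real.rpow_def_of_pos (by norm_num)]
        have := Real.add_one_le_exp (Real.log 2 * (32 * G))
        nlinarith
      have h3 : (2 : ℝ) ^ (10 * (n : ℝ)) = 1024 ^ n := by
        rw [Real.rpow_mul (by norm_num), Real.rpow_natCast]; norm_num
      rw [Real.rpow_add (by norm_num), h3] at h1
      exact le_trans (by gcongr) h1
    have h8 : (1 : ℝ) ≤ 8 ^ n := one_le_pow₀ (by norm_num)
    have h8l : 1 ≤ 8 ^ n * l := by nlinarith
    have e1 : 1 + K * L ≤ (1 + K * A) * (8 ^ n * l) := by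
      have : K * L ≤ K * (A * 8 ^ n * l) := by gcongr
      nlinarith
    have e2 : 8 * 4 ^ n + 5 * (1 + L / δ) ≤ (13 + 5 * (A / δ)) * (8 ^ n * l) := by
      have h1 : L / δ ≤ A / δ * (8 ^ n * l) := by
        rw [div_mul_eq_mul_div]
        gcongr
        linarith
      have h2 : (4 : ℝ) ^ n ≤ 8 ^ n := pow_le_pow_left₀ (by norm_num) (by norm_num) n
      have h3 : (8 : ℝ) ^ n ≤ 8 ^ n * l := le_mul_of_one_le_right (by positivity) hl1
      nlinarith
    calc 16 * (16 ^ n * (1 + K * L) / X) * (8 * 4 ^ n + 5 * (1 + L / δ))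
        ≤ 16 * (16 ^ n * ((1 + K * A) * (8 ^ n * l)) / X) *
            ((13 + 5 * (A / δ)) * (8 ^ n * l)) := by gcongr
      _ = G * (16 * 8 * 8) ^ n * l ^ 2 / X := by rw [hG, mul_pow, mul_pow]; ring
      _ ≤ G * (16 * 8 * 8) ^ n * (16 * Y) / X := by gcongr
      _ = 16 * G * 1024 ^ n / Y := by rw [hYX]; field_simp; norm_num
      _ ≤ 1 := (div_le_one hY0).mpr hYbig

/-! ### The number of samples -/

/-- The defining property of the number of samples bounds it from both sides. -/
theorem sample_count_bounds {δ : ℝ} (hδ : 0 < δ) {N m : ℕ}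
    (hm : IsLeast {k : ℕ | 0 < k ∧ (N : ℝ) ≤ (k : ℝ) ^ (δ * k)} m)
    (hN : (2 : ℝ) ^ (24 * δ) < N) : 9 ≤ m ∧ (m : ℝ) ≤ 1 + Real.log N / δ := by
  obtain ⟨⟨hm0, hm1⟩, hmin⟩ := hm
  have h9 : 9 ≤ m := by
    by_contra hlt
    have h8 : (m : ℝ) ≤ 8 := by exact_mod_cast (by omega : m ≤ 8)
    have hm1' : (1 : ℝ) ≤ m := by exact_mod_cast hm0
    have h1 : (m : ℝ) ^ (δ * m) ≤ (8 : ℝ) ^ (δ * 8) :=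
      (Real.rpow_le_rpow_of_exponent_le hm1' (by gcongr)).trans
        (Real.rpow_le_rpow (by positivity) h8 (by positivity))
    have h2 : (8 : ℝ) ^ (δ * 8) = 2 ^ (24 * δ) := by
      rw [show (8 : ℝ) = 2 ^ (3 : ℝ) by norm_num, ← Real.rpow_mul (by norm_num)]
      congr 1
      norm_num
      ring
    linarith
  refine ⟨h9, ?_⟩
  -- By minimality `m - 1` violates the defining inequality, and `log (m - 1) ≥ 1`.
  obtain ⟨k, rfl⟩ : ∃ k, m = k + 1 := ⟨m - 1, by omega⟩
  have hk : (8 : ℝ) ≤ k := by exact_mod_cast (by omega : 8 ≤ k)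
  have h3 : (k : ℝ) ^ (δ * k) < N := by
    by_contra hge
    have := hmin ⟨by omega, not_lt.mp hge⟩
    omega
  have h4 := Real.log_lt_log (by positivity) h3
  rw [Real.log_rpow (by linarith)] at h4
  have h5 : 1 ≤ Real.log k := by
    rw [Real.le_log_iff_exp_le (by linarith)]
    linarith [Real.exp_one_lt_d9]
  have h6 : δ * k ≤ δ * k * Real.log k := le_mul_of_one_le_right (by positivity) h5
  have h7 : (k : ℝ) ≤ Real.log N / δ := by
    rw [le_div_iff₀' hδ]; linarith
  push_cast
  linarith

end SNFLattice

open SNFLattice in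
theorem mainTheorem8 (δ K : ℝ) (hδ : 0 < δ) (hK : 0 < K) :
    ∃ C : ℝ, 0 < C ∧
      ∀ (n : ℕ) [NeZero n]
        -- the input: a nonsingular integer matrix and an integer vector
        (B : Matrix (Fin n) (Fin n) ℤ) (_ : B.det ≠ 0) (v : Fin n → ℤ)
        -- an LLL-reduced basis `B U` of `L(B)` and its QR decomposition
        (U : GL (Fin n) ℤ) (Q R : Matrix (Fin n) (Fin n) ℝ)
        (_ : Q ∈ Matrix.orthogonalGroup (Fin n) ℝ)
        (_ : SNFLattice.toReal (B * (U : Matrix (Fin n) (Fin n) ℤ)) = Q * R)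
        (_ : SNFLattice.IsLLLReduced R)
        -- the reduction of `R` to systematic normal form, at a sufficiently fine scale `1/T`
        (T N : ℕ) [Fact N.Prime] (BSNF : Matrix (Fin n) (Fin n) ℤ) (M : GL (Fin n) ℤ)
        (_ : SNFLattice.IsSNFReduction K R N BSNF M T)
        (_ : (2 : ℝ) ^ (C * n) /
          SNFLattice.successiveMinimum (SNFLattice.lattice (SNFLattice.toReal B)) 1 ≤ T)
        (_ : |(B.det : ℝ)| ≤ T)
        -- the number of samples, and the oracle
        (m : ℕ) (_ : IsLeast {k : ℕ | 0 < k ∧ (N : ℝ) ≤ (k : ℝ) ^ (δ * k)} m)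
        (A : (Fin m → ZMod N) → PMF (Option (Fin m → ZMod N)))
        -- the Gaussian parameter `s = T · η_ε(L(B))` with `ε = m^{-5}`
        (s : ℝ) (_ : s = T * SNFLattice.smoothingParameter ((m : ℝ) ^ (-5 : ℤ))
          (SNFLattice.toReal B))
        -- the two guesses
        (c₁ c₂ : ZMod N),
        SNFLattice.statDist
          (SNFLattice.coefficientLaw BSNF T s (Qᵀ *ᵥ fun i => (v i : ℝ)) A c₁)
          (SNFLattice.coefficientLaw BSNF T s (Qᵀ *ᵥ fun i => (v i : ℝ)) A c₂)
          ≤ (m : ℝ) ^ (-3 : ℤ) := by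
  obtain ⟨C, hC, hconst⟩ :=
    exists_scale_constant (A := 8 + 2 / K + 4 * K) hδ hK (by positivity)
  refine ⟨C, hC, ?_⟩
  intro n _ B hB v U Q R hQ hQR hR T N hprime BSNF M hred hT1 hT2 m hm A s hs c₁ c₂
  have hn : 1 ≤ n := NeZero.one_le
  have hdetR : |R.det| = |(B.det : ℝ)| := by
    have h1 := congrArg (fun A => |Matrix.det A|) hQR
    simp only [det_toReal, Matrix.det_mul, abs_mul, Int.cast_mul, abs_det_orthogonal hQ,
      one_mul] at h1
    rw [← h1, ← Int.cast_abs (a := (U : Matrix (Fin n) (Fin n) ℤ).det), abs_det_GL]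
    simp
  have hBR : (1 : ℝ) ≤ |(B.det : ℝ)| := by exact_mod_cast Int.one_le_abs hB
  have hR0 : R.det ≠ 0 := by
    rw [← abs_pos, hdetR]; linarith
  have hB' : (toReal B).det ≠ 0 := by rw [det_toReal]; exact_mod_cast hB
  have hT : (1 : ℝ) ≤ T := hBR.trans hT2
  have hT0 : (0 : ℝ) < T := by linarith
  obtain ⟨x, hxL, hx0, hxR⟩ := IsLLLReduced.exists_mem_lattice hQ hQR hR hR0
  set l₁ := successiveMinimum (lattice (toReal B)) 1 with hl₁
  have hl1 : 1 ≤ l₁ := one_le_successiveMinimum B hxL hx0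
  have hlR : l₁ ≤ |R 0 0| := hxR ▸ successiveMinimum_one_le hxL hx0
  -- `X = λ₁ T` measures how fine the rounding is compared with the lattice.
  set X := l₁ * T with hXdef
  have hX0 : 0 < X := by positivity
  have hTX : (T : ℝ) ≤ X := le_mul_of_one_le_left hT0.le hl1
  have hX : (2 : ℝ) ^ (C * n) ≤ X := by
    rwa [div_le_iff₀' (by linarith)] at hT1
  obtain ⟨hlogX, hXbig, hbudget⟩ := hconst n X hn hX
  obtain ⟨hSNF, d, hd, hBP⟩ := hred
  set P := perturbedBasis R T d with hP
  have hN0 : 0 < N := hprime.out.pos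
  have hdetP : |(P.det : ℝ)| = N := by
    have h1 := congrArg (fun A => |Matrix.det A|) hBP
    simp only [hSNF.det_eq, Matrix.det_mul, abs_mul, abs_det_GL, mul_one, Nat.abs_cast] at h1
    rw [← Int.cast_abs, ← h1]
    simp
  have hP0 : P.det ≠ 0 := by
    intro h
    rw [h] at hdetP
    simp only [Int.cast_zero, abs_zero] at hdetP
    exact hN0.ne (by exact_mod_cast hdetP)
  have hP0' : (toReal P).det ≠ 0 := by rw [det_toReal]; exact_mod_cast hP0
  have hE := abs_perturbedBasis_sub_le hR T hd
  have hL0 : 0 ≤ Real.log N := Real.log_natCast_nonneg N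
  have hLN := log_det_le hR (hl1.trans hlR) hK hT (hdetR ▸ hT2) hE hdetP hN0 hTX hlogX
  have hmain := hbudget _ hL0 hLN
  set τ := 16 ^ n * (1 + K * Real.log N) / X with hτ
  have hτ0 : 0 < τ := by positivity
  have h4 : (1 : ℝ) ≤ 4 ^ n := one_le_pow₀ (by norm_num)
  have hLδ : 0 ≤ Real.log N / δ := by positivity
  have hτ1 : τ ≤ 1 / 4 := by nlinarith
  have hclose : ∀ w w' : Fin n → ℝ, Rᵀ *ᵥ w = (toReal P)ᵀ *ᵥ w' →
      euclNorm (w - (T : ℝ) • w') ≤ τ * (T * euclNorm w') := fun w w' h => by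
    have h1 := hR.euclNorm_sub_smul_mul_le hR0 hE h
    have h2 : euclNorm (w - (T : ℝ) • w') * l₁ ≤ 16 ^ n * (1 + K * Real.log N) * euclNorm w' :=
      le_trans (mul_le_mul_of_nonneg_left hlR (euclNorm_nonneg _)) h1
    rw [← le_div_iff₀ (by linarith)] at h2
    refine h2.trans_eq ?_
    rw [hτ, hXdef]
    field_simp
  have hNbig : (2 : ℝ) ^ (24 * δ) < N := by
    have h1 := hR.mul_diag_le_det hR0 hP0 hT0 fun w w' h => (hclose w w' h).trans (by
      have := euclNorm_nonneg w'
      gcongr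
      linarith)
    rw [hdetP] at h1
    have h2 : X ≤ T * |R 0 0| := by rw [hXdef, mul_comm]; gcongr
    have h8 : (0 : ℝ) < 2 * 8 ^ n := by positivity
    exact lt_of_mul_lt_mul_left (hXbig.trans_le (h2.trans h1)) h8.le
  obtain ⟨hm9, hmle⟩ := sample_count_bounds hδ hm hNbig
  have hm9' : (9 : ℝ) ≤ m := by exact_mod_cast hm9
  have hm0 : (0 : ℝ) < m := by linarith
  set ε := (m : ℝ) ^ (-5 : ℤ) with hεdef
  have hε : ε = ((m : ℝ) ^ 5)⁻¹ := by rw [hεdef, zpow_neg]; rfl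
  have hε0 : 0 < ε := by rw [hε]; positivity
  have hεexp : ε = Real.exp (-(5 * Real.log m)) := by
    rw [Real.exp_neg, hε]
    congr 1
    rw [mul_comm, Real.exp_mul, Real.exp_log hm0]
    norm_cast
  have hεpi : ε ≤ Real.exp (-Real.pi) := by
    rw [hεexp]
    refine Real.exp_le_exp.mpr ?_
    have h1 : 1 ≤ Real.log m := by
      rw [Real.le_log_iff_exp_le hm0]
      linarith [Real.exp_one_lt_d9]
    linarith [Real.pi_lt_four]
  -- The far terms cost `exp (8 · 4ⁿ)`, which `1 / (16 τ)` absorbs together with `log (1 / ε)`.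
  have htail : Real.exp (-(1 / (16 * τ))) * Real.exp (8 * 4 ^ n) ≤ ε := by
    rw [hεexp, ← Real.exp_add]
    refine Real.exp_le_exp.mpr ?_
    have h1 : 8 * 4 ^ n + 5 * (1 + Real.log N / δ) ≤ 1 / (16 * τ) := by
      rw [le_div_iff₀ (by positivity)]
      linarith
    have h2 : Real.log m ≤ m := (Real.log_le_sub_one_of_pos hm0).trans (by linarith)
    linarith
  have hsums : ∀ r, dualGaussSum (toReal B) r = dualGaussSum R r := fun r => by
    rw [← dualGaussSum_mul_GL (toReal B) U, ← toReal_mul, hQR, dualGaussSum_orthogonal_mul hQ]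
  -- `L(B)` and `L(R)` are isometric, so that the smoothing parameter can be computed from `R`.
  have hη : smoothingParameter ε (toReal B) = sInf (smoothingSet ε R) := by
    rw [smoothingParameter_eq_sInf ε hB']
    simp only [smoothingSet, hsums]
  rw [hη] at hs
  set η := sInf (smoothingSet ε R) with hηdef
  have hdiag := hR.abs_diag_le_sInf hR0 hε0 hεpi
  have hη0 : 0 < η := by
    have h1 := hl1.trans (hlR.trans (hdiag 0))
    by_contra hneg
    have h2 : (8 : ℝ) ^ n * η ≤ 0 := mul_nonpos_of_nonneg_of_nonpos (by positivity) (not_lt.mp hneg)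
    linarith
  have hsum : dualGaussSum (toReal BSNF) s ≤ ENNReal.ofReal (3 * ε) := by
    rw [hBP, toReal_mul, dualGaussSum_mul_GL, hs]
    refine (hR.dualGaussSum_perturbed_le hR0 hP0' hη0 hε0.le hdiag
      (hR.dualGaussSum_sInf_le hR0 hε0) hT0 hτ0 hτ1 hclose).trans ?_
    exact ENNReal.ofReal_le_ofReal (by linarith)
  have hs0 : 0 < s := by rw [hs]; positivity
  have hε1 : 3 * ε ≤ 1 / 9 := by
    rw [hε, ← div_eq_mul_inv, div_le_div_iff₀ (by positivity) (by norm_num)]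
    have : (9 : ℝ) ^ 5 ≤ (m : ℝ) ^ 5 := pow_le_pow_left₀ (by norm_num) hm9' 5
    linarith
  refine (hSNF.statDist_coefficientLaw_le hs0 (by positivity) (by linarith) hsum T _ A
    c₁ c₂).trans ?_
  have h1 : 3 * ε / (1 - 3 * ε) ≤ 27 / 8 * ε := by
    rw [div_le_iff₀ (by linarith)]
    nlinarith
  have h2 : (m : ℝ) ^ (-3 : ℤ) = m ^ 2 * ε := by
    rw [hε, zpow_neg]
    field_simp
  rw [h2]
  calc 2 * (m * (3 * ε / (1 - 3 * ε))) ≤ 2 * (m * (27 / 8 * ε)) := by gcongr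
    _ = 27 / 4 * (m * ε) := by ring
    _ ≤ m * (m * ε) := by gcongr; linarith
    _ = _ := by ring
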